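/- **Setting.** For each $n$ let $0<\beta=\beta_n<\alpha=\alpha_n<1$ and put $\rho=\frac{(1-\alpha^2)(1-\beta^2)}{(1-\alpha\beta)^2}$, $t=\big\lceil \frac{\log^{1/8}n}{1-\alpha^2}\big\rceil$, $\tilde m=\big\lceil n^{\frac1t\frac{1-\beta^2}{(1-\alpha\beta)^2}}\big\rceil$ and $\eta=\alpha\sqrt{2\log\tilde m}-\sqrt{2(1-\alpha^2)\log\log\tilde m}$. The data structure $\mathtt{TensorCloseTop\text{-}1}$ for a data set $\mathcal S=\{x_1,\dots,x_n\}\subset\mathbb S^{d-1}\subset\mathbb R^d$ concatenates $t$ independent $\mathtt{CloseTop\text{-}1}$ structures. The $i$-th of them draws $\tilde m$ independent standard Gaussian vectors $a_{i,1},\dots,a_{i,\tilde m}$ in $\mathbb R^d$ and sends a point $x$ to the first index $j$ with $\sqrt{2\log\tilde m}-\frac32\frac{\log\log\tilde m}{\sqrt{2\log\tilde m}}\le\langle a_{i,j},x\rangle\le\sqrt{2\log\tilde m}$. Each $x\in\mathcal S$ for which such an index $j_i$ exists for every $i\le t$ is stored in the bucket $(j_1,\dots,j_t)$ of a hash table;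 the other points are not stored. A query $q\in\mathbb S^{d-1}$ computes $B_i=\{j:\langle a_{i,j},q\rangle\ge\eta\}$ for $i\le t$, inspects the buckets with address in $B_1\times\dots\times B_t$, and returns the first point $x$ it meets with $\langle q,x\rangle\ge\beta$ (or none). A point $x\in\mathcal S$ is *close* if $\langle q,x\rangle\ge\alpha$ and *far* if $\langle q,x\rangle<\beta$. Time is the number of elementary steps on a real RAM; an inner product takes $O(d)$ steps and an access to the hash table $O(t)$ steps (plus $O(d)$ steps to write an inserted point). Space is the number of memory cells of the data structure, a cell holding one real number, one index or one bucket address. **Theorem.** Assume, as $n\to\infty$, that $\rho=O(1)$, $1-\alpha^2=\omega(\log^{-3/4}n)$ and $\alpha-\beta=\omega\Big(\sqrt{\frac{\log\log n}{\log^{13/8}n}}\Big)$. Then $\mathtt{TensorCloseTop\text{-}1}$ uses space $O(d\cdot n)$, preprocessing time at most $d\cdot n^{1+o(1)}$, and expected query time at most $d\cdot n^{\rho+o(1)}$. In addition: 1. a query inspects in expectation at most $n^{\rho+o(1)}$ buckets; 2. there are in expectation at most $n^{\rho+o(1)}$ far points in the buckets inspected by a query. If moreover $\rho$ is bounded away from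 $0$ (that is, $\rho=\Theta(1)$), then 3. every close point is present in the buckets inspected by the query with probability $1-o(1)$, and $\mathtt{TensorCloseTop\text{-}1}$ solves the $(\alpha,\beta)$-ANN problem with probability $1-o(1)$: for every query $q$ such that $\mathcal S$ contains a point $x$ with $\langle q,x\rangle\ge\alpha$, the query returns a point $y\in\mathcal S$ with $\langle q,y\rangle\ge\beta$ with probability at least $1-o(1)$. The $o(1)$ terms and the constant of $O(d\cdot n)$ depend only on the sequences $(\alpha_n),(\beta_n)$; they are uniform over all dimensions $d$, data sets and queries, and the bounds hold for all sufficiently large $n$. -/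

import Mathlib

open MeasureTheory ProbabilityTheory
open Filter (Tendsto atTop)
open scoped ENNReal Topology Asymptotics

namespace TensorANN

/-- The ambient space `ℝ^d`, with its Euclidean norm and inner product. -/
abbrev E (d : ℕ) := EuclideanSpace ℝ (Fin d)

/-! ### Step counting -/

/-- The result of a computation on a real RAM, with the number of elementary steps it took. -/
structure Timed (α : Type) where
  val : α
  time : ℕ

/-- Sequential composition adds up the numbers of steps. -/
instance : Monad Timed where
  pure x := ⟨x, 0⟩
  bind x f := ⟨(f x.val).val, x.time + (f x.val).time⟩

/-- Spend `k` elementary steps. -/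
def tick (k : ℕ) : Timed Unit := ⟨(), k⟩

/-- The inner product of two vectors: `d` multiplications and fewer than `d` additions. -/
noncomputable def dot {d : ℕ} (a x : E d) : Timed ℝ := do
  tick (2 * d)
  return inner ℝ a x

/-! ### Hash tables -/

/-- A hash table, given by the list of its records (bucket address, stored point). -/
structure HashTable (m d : ℕ) where
  records : List (List (Fin m) × E d)

/-- The empty hash table. -/
def HashTable.empty (m d : ℕ) : HashTable m d := ⟨[]⟩

/-- Insertion: read the address, write the `d` coordinates of the point, one more step. -/
def HashTable.insert {m d : ℕ} (H : HashTable m d) (key : List (Fin m)) (x : E d) :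
    Timed (HashTable m d) := do
  tick (key.length + d + 1)
  return ⟨(key, x) :: H.records⟩

/-- The points in the bucket with a given address. -/
def HashTable.bucket {m d : ℕ} (H : HashTable m d) (key : List (Fin m)) : List (E d) :=
  (H.records.filter (fun r => r.1 = key)).map Prod.snd

/-- Access to a bucket: read the address, one more step. Going through the points of the bucket
is charged separately. -/
def HashTable.lookup {m d : ℕ} (H : HashTable m d) (key : List (Fin m)) : Timed (List (E d)) := do
  tick (key.length + 1)
  return H.bucket key

/-! ### Parameters -/

/-- `ρ = (1 - α²)(1 - β²) / (1 - αβ)²`. -/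
noncomputable def rho (α β : ℝ) : ℝ := (1 - α ^ 2) * (1 - β ^ 2) / (1 - α * β) ^ 2

/-- The number `t = ⌈log^{1/8} n / (1 - α²)⌉` of concatenated structures. -/
noncomputable def levels (n : ℕ) (α : ℝ) : ℕ :=
  ⌈Real.log n ^ (1 / 8 : ℝ) / (1 - α ^ 2)⌉₊

/-- The number `m = ⌈n^{(1/t) (1 - β²) / (1 - αβ)²}⌉` of Gaussian vectors in each structure. -/
noncomputable def filters (n : ℕ) (α β : ℝ) : ℕ :=
  ⌈(n : ℝ) ^ ((1 / (levels n α : ℝ)) * ((1 - β ^ 2) / (1 - α * β) ^ 2))⌉₊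

/-- Upper end `√(2 log m)` of the storing interval. -/
noncomputable def bandUpper (m : ℕ) : ℝ := √(2 * Real.log m)

/-- Lower end `√(2 log m) - (3/2) log log m / √(2 log m)` of the storing interval. -/
noncomputable def bandLower (m : ℕ) : ℝ :=
  √(2 * Real.log m) - 3 / 2 * (Real.log (Real.log m) / √(2 * Real.log m))

/-- The query threshold `η = α √(2 log m) - √(2 (1 - α²) log log m)`. -/
noncomputable def threshold (α : ℝ) (m : ℕ) : ℝ :=
  α * √(2 * Real.log m) - √(2 * (1 - α ^ 2) * Real.log (Real.log m))

/-! ### One `CloseTop-1` structure with `m` Gaussian vectors `a 0, …, a (m - 1)` -/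

/-- The first index of the list `js` whose vector has inner product with `x` in `[lo, hi]`;
one inner product and two comparisons for each index that is tried. -/
noncomputable def CloseTop1.hashFrom {d m : ℕ} (lo hi : ℝ) (a : Fin m → E d) (x : E d) :
    List (Fin m) → Timed (Option (Fin m))
  | [] => return none
  | j :: js => do
    let s ← dot (a j) x
    tick 2
    if lo ≤ s ∧ s ≤ hi then return some j else CloseTop1.hashFrom lo hi a x js

/-- The bucket of `x`, or `none` if no vector is close enough and `x` is not stored. -/
noncomputable def CloseTop1.hash {d m : ℕ} (a : Fin m → E d) (x : E d) :
    Timed (Option (Fin m)) :=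
  CloseTop1.hashFrom (bandLower m) (bandUpper m) a x (List.finRange m)

/-- The indices in `js` whose vector has inner product at least `η` with `q`. -/
noncomputable def CloseTop1.searchFrom {d m : ℕ} (η : ℝ) (a : Fin m → E d) (q : E d) :
    List (Fin m) → Timed (List (Fin m))
  | [] => return []
  | j :: js => do
    let s ← dot (a j) q
    tick 2
    let B ← CloseTop1.searchFrom η a q js
    if η ≤ s then return j :: B else return B

/-- The buckets that the query `q` selects. -/
noncomputable def CloseTop1.search {d m : ℕ} (η : ℝ) (a : Fin m → E d) (q : E d) :
    Timed (List (Fin m)) :=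
  CloseTop1.searchFrom η a q (List.finRange m)

/-! ### `TensorCloseTop-1` -/

/-- The data structure: `t` families of `m` vectors, one hash table, and the two thresholds. -/
structure TensorCloseTop1 (d t m : ℕ) where
  vectors : Fin t → Fin m → E d
  table : HashTable m d
  η : ℝ
  β : ℝ

namespace TensorCloseTop1

/-- The concatenation of the hashes of `x` in the structures of the list; `none` if one of these
structures does not store `x`. -/
noncomputable def keyFrom {d t m : ℕ} (a : Fin t → Fin m → E d) (x : E d) :
    List (Fin t) → Timed (Option (List (Fin m)))
  | [] => return some []
  | i :: is => do
    let h ← CloseTop1.hash (a i) x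
    tick 1
    match h with
    | none => return none
    | some j => do
      let k ← keyFrom a x is
      return k.map (fun js => j :: js)

/-- Insert the points of a list into the table; a point without an address is dropped. -/
noncomputable def insertAll {d t m : ℕ} (a : Fin t → Fin m → E d) (H : HashTable m d) :
    List (E d) → Timed (HashTable m d)
  | [] => return H
  | x :: xs => do
    let k ← keyFrom a x (List.finRange t)
    tick 1
    match k with
    | none => insertAll a H xs
    | some key => do
      let H' ← H.insert key x
      insertAll a H' xs

/-- The construction for the points `x 0, …, x (n - 1)`, as a function of the vectors `a` that are
drawn. The first charge is for the parameters (a bounded number of arithmetic operations, roots,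
powers and logarithms), the second one for drawing the `t * m * d` Gaussian coordinates. -/
noncomputable def construct {d n : ℕ} (α β : ℝ) (x : Fin n → E d)
    (a : Fin (levels n α) → Fin (filters n α β) → E d) :
    Timed (TensorCloseTop1 d (levels n α) (filters n α β)) := do
  tick 64
  tick (levels n α * filters n α β * d)
  let H ← insertAll a (HashTable.empty (filters n α β) d) (List.ofFn x)
  return ⟨a, H, threshold α (filters n α β), β⟩

/-- The number of memory cells, where a cell holds one real number, one index or one bucket
address: `d` cells for each Gaussian vector; for each record `d` cells for the point and three for
its bucket address, a link and a slot of the table; four cells for `t`, `m`, `η` and `β`. -/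
def space {d t m : ℕ} (D : TensorCloseTop1 d t m) : ℕ :=
  t * m * d + D.table.records.length * (d + 3) + 4

/-- The results of the search for `q` in the structures of the list. -/
noncomputable def searchFrom {d t m : ℕ} (D : TensorCloseTop1 d t m) (q : E d) :
    List (Fin t) → Timed (List (List (Fin m)))
  | [] => return []
  | i :: is => do
    let B ← CloseTop1.search D.η (D.vectors i) q
    tick 1
    let Bs ← searchFrom D q is
    return B :: Bs

/-- The addresses of the buckets to inspect: the Cartesian product of the results of the `t`
searches, enumerated with `t` steps for each tuple. -/
noncomputable def buckets {d t m : ℕ} (D : TensorCloseTop1 d t m) (q : E d) :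
    Timed (List (List (Fin m))) := do
  let Bs ← D.searchFrom q (List.finRange t)
  tick (t * (Bs.sections.length + 1))
  return Bs.sections

/-- The first point of a bucket with inner product at least `β` with `q`. -/
noncomputable def scanBucket {d : ℕ} (β : ℝ) (q : E d) : List (E d) → Timed (Option (E d))
  | [] => return none
  | x :: xs => do
    let s ← dot q x
    tick 1
    if β ≤ s then return some x else scanBucket β q xs

/-- Go through a list of buckets and stop at the first point with inner product at least `β`. -/
noncomputable def scanBuckets {d t m : ℕ} (D : TensorCloseTop1 d t m) (q : E d) :
    List (List (Fin m)) → Timed (Option (E d))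
  | [] => return none
  | key :: keys => do
    let b ← D.table.lookup key
    let r ← scanBucket D.β q b
    match r with
    | some x => return some x
    | none => scanBuckets D q keys

/-- The query. -/
noncomputable def query {d t m : ℕ} (D : TensorCloseTop1 d t m) (q : E d) :
    Timed (Option (E d)) := do
  let B ← D.buckets q
  D.scanBuckets q B

/-- The number of buckets that the query `q` inspects. -/
noncomputable def numBuckets {d t m : ℕ} (D : TensorCloseTop1 d t m) (q : E d) : ℕ :=
  (D.buckets q).val.length

/-- All the points in the buckets that the query `q` inspects. -/
noncomputable def inspected {d t m : ℕ} (D : TensorCloseTop1 d t m) (q : E d) : List (E d) :=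
  (D.buckets q).val.flatMap D.table.bucket

/-- The number of far points (inner product with `q` less than `β`) in these buckets. -/
noncomputable def numFar {d t m : ℕ} (D : TensorCloseTop1 d t m) (q : E d) : ℕ :=
  (D.inspected q).countP (fun y => inner ℝ q y < D.β)

end TensorCloseTop1

/-- The law of `t` independent families of `m` independent standard Gaussian vectors in `ℝ^d`. -/
noncomputable def gaussians (d t m : ℕ) : Measure (Fin t → Fin m → E d) :=
  Measure.pi (fun _ => Measure.pi (fun _ => stdGaussian (E d)))

/-- A correct answer to the near neighbour query `q`: a point of the data set in `B(q, β)`. -/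
def IsNearNeighbor {d n : ℕ} (β : ℝ) (x : Fin n → E d) (q : E d) (r : Option (E d)) : Prop :=
  ∃ i, r = some (x i) ∧ β ≤ inner ℝ q (x i)

end TensorANN

namespace TensorANN

/-! ### The standard Gaussian measure -/

/-! Write `M = log m`, `ℓ = log log m`, `σ = (1 - β²) / (1 - αβ)²`, so that `ρ = (1 - α²) σ`. The
choice of `m` makes `t M` equal to `σ log n` up to an additive `t`. The `t` structures are
independent, so every estimate reduces to one Gaussian vector `a`.

Buckets: the expected number is `(m P[⟨a, q⟩ ≥ η])^t`. Since `η ≈ α √(2M)`, it is about `exp (t (1 -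
α²) M) = n^ρ` (`buckets_exponent`).

Far points: to be inspected, a far `x` needs in every structure a vector in its band that also
exceeds `η` on `q`. A joint Chernoff bound along `x` and along the part of `q` orthogonal to `x`
(`stdGaussian_band_inter_le`) gives about `exp (-M - (α - β)² M / (1 - β²))`. The union bound over
`m` vectors cancels `exp (-M)`, and the `t`-th power leaves `n^(-(1 - ρ))` by the identity
`one_sub_rho`. Summing over `n` points gives `n^ρ` (`far_exponent`).

Close points: one structure fails if no vector meets the band, or if the first one that does falls
below `η` on `q`. The band has mass of order at least `M / m` (`le_stdGaussian_band_mul`), so the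
first event has probability `exp (-Ω(M))`. For the second, the orthogonal part of `q` is independent
of the band, and the offset in `η` makes a miss have conditional probability at most `e / M`. A
union bound gives failure `O(t / M)`, which is `O(log^(-3/4) n / (1 - α²))` when `ρ` is bounded
below. Since a query returns the first point that is not far, inspecting one close point suffices
for correctness.

Errors are measured in `s = log^(1/32) n`, for which `t (1 - α²) ≈ s⁴` and `log n = s³²`. All losses
in the exponents are `O(s³¹)`, hence a relative `O(1 / s)`. -/

lemma stdGaussian_map_inner {d : ℕ} (v : E d) :
    (stdGaussian (E d)).map (fun a => inner ℝ a v) = gaussianReal 0 (‖v‖₊ ^ 2) := by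
  have h1 : (fun a : E d => inner ℝ a v) = (innerSL ℝ v : E d → ℝ) := by
    ext a; simp [real_inner_comm]
  rw [h1, IsGaussian.map_eq_gaussianReal, integral_strongDual_stdGaussian,
    variance_dual_stdGaussian, innerSL_apply_norm]
  congr
  ext
  simp

lemma measurable_inner_left {d : ℕ} (v : E d) : Measurable (fun a : E d => inner ℝ a v) := by
  fun_prop

lemma lintegral_exp_inner_stdGaussian {d : ℕ} (v : E d) :
    ∫⁻ a, ENNReal.ofReal (Real.exp (inner ℝ a v)) ∂(stdGaussian (E d))
      = ENNReal.ofReal (Real.exp (‖v‖ ^ 2 / 2)) := by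
  have h1 := lintegral_map (μ := stdGaussian (E d))
    (f := fun y : ℝ => ENNReal.ofReal (Real.exp y)) (by fun_prop) (measurable_inner_left v)
  rw [← h1, stdGaussian_map_inner, ← ofReal_integral_eq_lintegral_ofReal]
  · have := mgf_gaussianReal (p := gaussianReal 0 (‖v‖₊ ^ 2)) (X := id)
      (μ := 0) (v := ‖v‖₊ ^ 2) Measure.map_id 1
    simp only [mgf, id, one_mul, zero_add, mul_one] at this
    rw [this]
    simp
  · simpa using integrable_exp_mul_gaussianReal (μ := 0) (v := ‖v‖₊ ^ 2) 1
  · exact Filter.Eventually.of_forall fun y => (Real.exp_pos y).le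

/-- Markov's inequality for the exponential moment. The Chernoff parameter is absorbed into `v`, so
a weighted sum of several linear constraints is handled by a single application. -/
lemma stdGaussian_le_inner {d : ℕ} (v : E d) (s : ℝ) :
    stdGaussian (E d) {a | s ≤ inner ℝ a v} ≤ ENNReal.ofReal (Real.exp (‖v‖ ^ 2 / 2 - s)) := by
  have h := meas_ge_le_lintegral_div (μ := stdGaussian (E d))
    (f := fun a => ENNReal.ofReal (Real.exp (inner ℝ a v))) (by fun_prop)
    (ε := ENNReal.ofReal (Real.exp s)) (by simp [Real.exp_pos]) (by simp)
  rw [lintegral_exp_inner_stdGaussian, ← ENNReal.ofReal_div_of_pos (Real.exp_pos _),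
    ← Real.exp_sub] at h
  refine le_trans (measure_mono fun a ha => ?_) h
  exact ENNReal.ofReal_le_ofReal (Real.exp_le_exp.2 ha)

/-- Gaussian tail bound. -/
lemma stdGaussian_tail {d : ℕ} (v : E d) {b w : ℝ} (hb : 0 < b) (hv : ‖v‖ ^ 2 ≤ b)
    (hw : 0 ≤ w) : stdGaussian (E d) {a | w ≤ inner ℝ a v}
      ≤ ENNReal.ofReal (Real.exp (-(w ^ 2 / (2 * b)))) := by
  refine le_trans (measure_mono (fun a (ha : w ≤ inner ℝ a v) => ?_))
    ((stdGaussian_le_inner ((w / b) • v) (w / b * w)).trans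
    (ENNReal.ofReal_le_ofReal (Real.exp_le_exp.2 ?_)))
  · simp only [Set.mem_ofPred_eq, inner_smul_right]
    exact mul_le_mul_of_nonneg_left ha (by positivity)
  · rw [norm_smul, mul_pow, Real.norm_eq_abs, sq_abs]
    have : (w / b) ^ 2 * ‖v‖ ^ 2 ≤ (w / b) ^ 2 * b := by gcongr
    have e1 : (w / b) ^ 2 * b / 2 - w / b * w = -(w ^ 2 / (2 * b)) := by field_simp; ring
    linarith

lemma norm_sq_sub_inner_smul {d : ℕ} {x q : E d} (hx : ‖x‖ = 1) (hq : ‖q‖ = 1) :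
    ‖q - (inner ℝ q x : ℝ) • x‖ ^ 2 = 1 - (inner ℝ q x : ℝ) ^ 2 := by
  rw [norm_sub_sq_real, inner_smul_right, norm_smul, hx, hq, Real.norm_eq_abs, mul_one, sq_abs]
  ring

lemma inner_sub_inner_smul {d : ℕ} {x : E d} (q : E d) (hx : ‖x‖ = 1) :
    inner ℝ x (q - (inner ℝ q x : ℝ) • x) = 0 := by
  rw [inner_sub_right, inner_smul_right, real_inner_self_eq_norm_sq, hx, real_inner_comm]
  ring

/-- Joint tail bound for a point in the band whose correlation with the query is at most `β`. -/
lemma stdGaussian_band_inter_le {d : ℕ} {x q : E d} (hx : ‖x‖ = 1) (hq : ‖q‖ = 1)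
    {β lo u η : ℝ} (hβ0 : 0 < β) (hβ1 : β < 1) (hlo : 0 ≤ lo) (hu : 0 ≤ u)
    (hc : inner ℝ q x ≤ β) (hη : β * u ≤ η) (hηu : η ≤ u) :
    stdGaussian (E d) {a | (lo ≤ inner ℝ a x ∧ inner ℝ a x ≤ u) ∧ η ≤ inner ℝ a q}
      ≤ ENNReal.ofReal (Real.exp (-(lo ^ 2 / 2) - (η - β * u) ^ 2 / (2 * (1 - β ^ 2)))) := by
  set c : ℝ := inner ℝ q x with hcdef
  set v := q - c • x with hv
  -- A negative `c` would spoil the upper bound `c ⟨a, x⟩ ≤ c u` on the band. Truncating at `0`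
  -- restores it, and `‖v‖² = 1 - c² ≤ 1 - c'²` still holds.
  set c' := max c 0 with hc'
  have hc'0 : 0 ≤ c' := le_max_right _ _
  have hc'β : c' ≤ β := max_le hc hβ0.le
  have hcc' : c ≤ c' := le_max_left _ _
  have hc'sq : c' ^ 2 ≤ c ^ 2 := by
    rcases le_total c 0 with h | h
    · rw [hc', max_eq_right h, zero_pow two_ne_zero]; exact sq_nonneg c
    · rw [hc', max_eq_left h]
  set b := 1 - c' ^ 2 with hb
  have hb0 : 0 < b := by nlinarith
  have hvb : ‖v‖ ^ 2 ≤ b := by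
    rw [hv, norm_sq_sub_inner_smul hx hq]; linarith
  have hxv : inner ℝ x v = 0 := inner_sub_inner_smul q hx
  set w := η - c' * u with hw
  have hw0 : 0 ≤ w := by nlinarith
  set l := w / b with hl
  have hl0 : 0 ≤ l := div_nonneg hw0 hb0.le
  -- The constraints along `x` and `v` are added with their optimal Chernoff weights `lo` and `l = w
  -- / b`; orthogonality splits the exponent.
  refine le_trans (measure_mono (t := {a | lo * lo + l * w ≤ inner ℝ a (lo • x + l • v)}) ?_)
    ((stdGaussian_le_inner _ _).trans (ENNReal.ofReal_le_ofReal (Real.exp_le_exp.2 ?_)))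
  · rintro a ⟨⟨h1, h2⟩, h3⟩
    simp only [Set.mem_ofPred_eq, inner_add_right, inner_smul_right]
    have h4 : w ≤ inner ℝ a v := by
      rw [hv, inner_sub_right, inner_smul_right]
      have h5 : c * inner ℝ a x ≤ c' * u :=
        (mul_le_mul_of_nonneg_right hcc' (hlo.trans h1)).trans (mul_le_mul_of_nonneg_left h2 hc'0)
      linarith
    have := mul_le_mul_of_nonneg_left h1 hlo
    have := mul_le_mul_of_nonneg_left h4 hl0
    linarith
  · have e1 : ‖lo • x + l • v‖ ^ 2 = lo ^ 2 + l ^ 2 * ‖v‖ ^ 2 := by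
      rw [norm_add_sq_real, inner_smul_left, inner_smul_right, hxv, norm_smul, norm_smul, hx]
      simp [mul_pow]
    have e2 : l ^ 2 * ‖v‖ ^ 2 ≤ l ^ 2 * b := by gcongr
    have e3 : l ^ 2 * b / 2 - l * w = -(w ^ 2 / (2 * b)) := by rw [hl]; field_simp; ring
    -- The function `c ↦ (η - c u)² / (1 - c²)` decreases on `[0, β]` because `η ≤ u`, so `c' = β`
    -- is the worst case.
    have e4 : (η - β * u) ^ 2 / (2 * (1 - β ^ 2)) ≤ w ^ 2 / (2 * b) := by
      have hβ2 : 0 < 1 - β ^ 2 := by nlinarith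
      rw [div_le_div_iff₀ (by positivity) (by positivity)]
      set G := η - β * u with hG
      have hG0 : 0 ≤ G := by linarith
      have hwG : w = G + (β - c') * u := by rw [hw, hG]; ring
      have h6 : G * (β + c') ≤ 2 * (1 - β ^ 2) * u := by
        have : G * β ≤ (1 - β ^ 2) * u := by nlinarith
        nlinarith
      have h7 : G * (G * (β + c') * (β - c')) ≤ G * (2 * (1 - β ^ 2) * u * (β - c')) :=
        mul_le_mul_of_nonneg_left (mul_le_mul_of_nonneg_right h6 (by linarith)) hG0
      have h8 : 0 ≤ (1 - β ^ 2) * ((β - c') * u) ^ 2 := by positivity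
      rw [hwG, hb]
      nlinarith
    rw [e1]
    linarith

/-- Lower bound for the mass of an interval. -/
lemma le_stdGaussian_band {d : ℕ} {x : E d} (hx : ‖x‖ = 1) {lo u w : ℝ} (hlo : 0 ≤ lo)
    (hu : lo + w ≤ u) :
    ENNReal.ofReal (w * ((√(2 * Real.pi))⁻¹ * Real.exp (-((lo + w) ^ 2 / 2))))
      ≤ stdGaussian (E d) {a | lo ≤ inner ℝ a x ∧ inner ℝ a x ≤ u} := by
  have h1 := Measure.map_apply (μ := stdGaussian (E d)) (measurable_inner_left x)
    (measurableSet_Icc (a := lo) (b := u))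
  have h2 : (fun a : E d => inner ℝ a x) ⁻¹' Set.Icc lo u
      = {a | lo ≤ inner ℝ a x ∧ inner ℝ a x ≤ u} := rfl
  rw [← h2, ← h1, stdGaussian_map_inner, gaussianReal_apply _ (by simp [← norm_ne_zero_iff, hx])]
  have h3 : Set.Icc lo (lo + w) ⊆ Set.Icc lo u := Set.Icc_subset_Icc_right hu
  refine le_trans ?_ (lintegral_mono_set h3)
  calc _ = ∫⁻ _ in Set.Icc lo (lo + w),
        ENNReal.ofReal ((√(2 * Real.pi))⁻¹ * Real.exp (-((lo + w) ^ 2 / 2))) := by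
        rw [setLIntegral_const, Real.volume_Icc, add_sub_cancel_left, mul_comm w,
          ENNReal.ofReal_mul (by positivity)]
    _ ≤ _ := by
        refine setLIntegral_mono (by fun_prop) fun y hy => ?_
        rw [gaussianPDF, gaussianPDFReal]
        have hx' : ‖x‖₊ = 1 := by ext; simpa using hx
        simp only [hx', one_pow, NNReal.coe_one, mul_one, sub_zero]
        refine ENNReal.ofReal_le_ofReal ?_
        gcongr
        rw [neg_div]
        have : y ^ 2 ≤ (lo + w) ^ 2 := pow_le_pow_left₀ (hlo.trans hy.1) hy.2 2
        linarith

/-- The two projections are jointly Gaussian with covariance `⟨x, v⟩`, so orthogonality means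
independence. -/
lemma indepFun_inner {d : ℕ} {x v : E d} (h : inner ℝ x v = 0) :
    IndepFun (fun a => inner ℝ a x) (fun a => inner ℝ a v) (stdGaussian (E d)) := by
  have e (y : E d) : (fun a => inner ℝ a y : E d → ℝ) = fun a => inner ℝ y a := by
    ext a; exact real_inner_comm _ _
  apply HasGaussianLaw.indepFun_of_covariance_eq_zero
  · have h1 : HasGaussianLaw (id : E d → E d) (stdGaussian (E d)) :=
      ⟨by rw [Measure.map_id]; infer_instance⟩
    have := h1.map ((innerSL ℝ x).prod (innerSL ℝ v))
    have e2 : (fun a => (inner ℝ a x, inner ℝ a v) : E d → ℝ × ℝ)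
        = ⇑((innerSL ℝ x).prod (innerSL ℝ v)) ∘ id := by
      ext a <;> simp [real_inner_comm]
    rw [e2]
    exact this
  · rw [e, e, ← covarianceBilin_apply_eq_cov, covarianceBilin_stdGaussian, innerSL_apply_apply, h]
    exact IsGaussian.memLp_two_id

/-- A point in the band whose correlation with the query is at least `α` is rarely missed. -/
lemma stdGaussian_band_inter_lt_le {d : ℕ} {x q : E d} (hx : ‖x‖ = 1) (hq : ‖q‖ = 1)
    {α lo u η : ℝ} (hα0 : 0 < α) (hα1 : α < 1) (hlo : 0 ≤ lo)
    (hc : α ≤ inner ℝ q x) (hη : η ≤ α * lo) :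
    stdGaussian (E d) {a | (lo ≤ inner ℝ a x ∧ inner ℝ a x ≤ u) ∧ inner ℝ a q < η}
      ≤ stdGaussian (E d) {a | lo ≤ inner ℝ a x ∧ inner ℝ a x ≤ u} *
        ENNReal.ofReal (Real.exp (-((α * lo - η) ^ 2 / (2 * (1 - α ^ 2))))) := by
  set c : ℝ := inner ℝ q x with hcdef
  set v := q - c • x with hv
  have hind := indepFun_inner (inner_sub_inner_smul q hx)
  have h1 := hind.measure_inter_preimage_eq_mul _ _ (measurableSet_Icc (a := lo) (b := u))
    (measurableSet_Iic (a := -(α * lo - η)))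
  -- On the band `⟨a, q⟩ ≥ α lo + ⟨a, v⟩`, so a miss forces `⟨a, v⟩ ≤ -(α lo - η)`, an event
  -- independent of the band.
  refine le_trans (measure_mono ?_) (h1.le.trans (mul_le_mul' le_rfl ?_))
  · rintro a ⟨⟨h2, h3⟩, h4⟩
    refine ⟨⟨h2, h3⟩, ?_⟩
    simp only [Set.mem_preimage, Set.mem_Iic, inner_sub_right, inner_smul_right]
    have : α * lo ≤ c * inner ℝ a x :=
      mul_le_mul hc h2 hlo (hα0.le.trans hc)
    linarith
  · refine le_trans (measure_mono ?_) (stdGaussian_tail (-v) (b := 1 - α ^ 2)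
      (w := α * lo - η) (by nlinarith) ?_ (by linarith))
    · intro a ha
      simp only [Set.mem_preimage, Set.mem_Iic] at ha
      simp only [Set.mem_ofPred_eq, inner_neg_right]
      linarith
    · rw [norm_neg, hv, norm_sq_sub_inner_smul hx hq]
      have := pow_le_pow_left₀ hα0.le hc 2
      linarith

/-! ### Values and running times of the subroutines -/

@[simp] lemma Timed.bind_val {α β : Type} (x : Timed α) (f : α → Timed β) :
    (x >>= f).val = (f x.val).val := rfl

@[simp] lemma Timed.bind_time {α β : Type} (x : Timed α) (f : α → Timed β) :
    (x >>= f).time = x.time + (f x.val).time := rfl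

@[simp] lemma Timed.pure_val {α : Type} (x : α) : (pure x : Timed α).val = x := rfl

@[simp] lemma Timed.pure_time {α : Type} (x : α) : (pure x : Timed α).time = 0 := rfl

@[simp] lemma tick_time (k : ℕ) : (tick k).time = k := rfl

/-- The vectors whose inner product with `x` lies in the storing interval. -/
def band {d : ℕ} (m : ℕ) (x : E d) : Set (E d) :=
  {a | bandLower m ≤ inner ℝ a x ∧ inner ℝ a x ≤ bandUpper m}

namespace CloseTop1

lemma hashFrom_cons {d m : ℕ} (lo hi : ℝ) (a : Fin m → E d) (x : E d) (j : Fin m)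
    (js : List (Fin m)) :
    hashFrom lo hi a x (j :: js) = tick (2 * d) >>= fun _ => tick 2 >>= fun _ =>
      if lo ≤ inner ℝ (a j) x ∧ inner ℝ (a j) x ≤ hi then pure (some j)
      else hashFrom lo hi a x js := rfl

lemma searchFrom_cons {d m : ℕ} (η : ℝ) (a : Fin m → E d) (q : E d) (j : Fin m)
    (js : List (Fin m)) :
    searchFrom η a q (j :: js) = tick (2 * d) >>= fun _ => tick 2 >>= fun _ =>
      searchFrom η a q js >>= fun B => if η ≤ inner ℝ (a j) q then pure (j :: B) else pure B := rfl

open Classical in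
lemma hashFrom_val {d m : ℕ} (lo hi : ℝ) (a : Fin m → E d) (x : E d) (js : List (Fin m)) :
    (hashFrom lo hi a x js).val
      = js.find? (fun j => lo ≤ inner ℝ (a j) x ∧ inner ℝ (a j) x ≤ hi) := by
  induction js with
  | nil => rfl
  | cons j js ih =>
    rw [hashFrom_cons, List.find?_cons]
    by_cases h : lo ≤ inner ℝ (a j) x ∧ inner ℝ (a j) x ≤ hi
    · simp only [Timed.bind_val, if_pos h, Timed.pure_val, decide_eq_true h]
    · simp only [Timed.bind_val, if_neg h, ih, decide_eq_false h]

lemma hashFrom_time_le {d m : ℕ} (lo hi : ℝ) (a : Fin m → E d) (x : E d) (js : List (Fin m)) :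
    (hashFrom lo hi a x js).time ≤ js.length * (2 * d + 2) := by
  induction js with
  | nil => simp [hashFrom]
  | cons j js ih =>
    rw [hashFrom_cons]
    simp only [Timed.bind_time, tick_time, List.length_cons]
    split_ifs
    · rw [Timed.pure_time]; nlinarith
    · nlinarith

lemma hash_time_le {d m : ℕ} (a : Fin m → E d) (x : E d) :
    (hash a x).time ≤ m * (2 * d + 2) := by
  have := hashFrom_time_le (bandLower m) (bandUpper m) a x (List.finRange m)
  rwa [List.length_finRange] at this

open Classical in
lemma hash_val {d m : ℕ} (a : Fin m → E d) (x : E d) :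
    (hash a x).val = (List.finRange m).find? (fun j => a j ∈ band m x) := by
  rw [hash, hashFrom_val]
  congr
  ext j
  congr 1

open Classical in
lemma searchFrom_val {d m : ℕ} (η : ℝ) (a : Fin m → E d) (q : E d) (js : List (Fin m)) :
    (searchFrom η a q js).val = js.filter (fun j => η ≤ inner ℝ (a j) q) := by
  induction js with
  | nil => rfl
  | cons j js ih =>
    rw [searchFrom_cons, List.filter_cons]
    by_cases h : η ≤ inner ℝ (a j) q
    · simp [h, ih]
    · simp [h, ih]

lemma searchFrom_time {d m : ℕ} (η : ℝ) (a : Fin m → E d) (q : E d) (js : List (Fin m)) :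
    (searchFrom η a q js).time = js.length * (2 * d + 2) := by
  induction js with
  | nil => simp [searchFrom]
  | cons j js ih =>
    rw [searchFrom_cons]
    simp only [Timed.bind_time, tick_time, List.length_cons, ih]
    split_ifs <;> simp only [Timed.pure_time] <;> ring

open Classical in
lemma search_val {d m : ℕ} (η : ℝ) (a : Fin m → E d) (q : E d) :
    (search η a q).val = (List.finRange m).filter (fun j => η ≤ inner ℝ (a j) q) :=
  searchFrom_val η a q _

lemma search_time {d m : ℕ} (η : ℝ) (a : Fin m → E d) (q : E d) :
    (search η a q).time = m * (2 * d + 2) := by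
  have := searchFrom_time η a q (List.finRange m)
  rwa [List.length_finRange] at this

end CloseTop1

/-! ### Cartesian products of lists -/

lemma length_sections {α : Type*} (L : List (List α)) :
    L.sections.length = (L.map List.length).prod := by
  induction L with
  | nil => simp [List.sections]
  | cons l L ih =>
    simp [List.sections, List.length_flatMap, ih, mul_comm]

/-- Tuples with different tails are different, as are tuples with the same tail and different heads.
It ensures that no bucket is inspected twice, so each record counts at most once. -/
lemma count_sections_le_one {α : Type*} [DecidableEq α] {L : List (List α)}
    (hL : ∀ l ∈ L, l.Nodup) (s : List α) : L.sections.count s ≤ 1 := by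
  refine List.nodup_iff_count_le_one.1 ?_ s
  clear s
  induction L with
  | nil => simp [List.sections]
  | cons l L ih =>
    rw [List.sections, List.nodup_flatMap]
    refine ⟨fun s _ => (hL l (by simp)).map fun a b h => by simpa using h, ?_⟩
    refine (ih fun l hl => hL l (by simp [hl])).imp ?_
    intro s s' hss
    rw [Function.onFun, List.disjoint_left]
    simp only [List.mem_map, not_exists, not_and, forall_exists_index, and_imp]
    rintro _ b _ rfl c _ h
    exact hss (List.cons_eq_cons.1 h).2.symm

/-! ### The concatenated structure for fixed vectors -/

namespace TensorCloseTop1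

variable {d t m : ℕ}

lemma keyFrom_val_eq_some (a : Fin t → Fin m → E d) (x : E d) (is : List (Fin t))
    (key : List (Fin m)) :
    (keyFrom a x is).val = some key ↔
      List.Forall₂ (fun i j => (CloseTop1.hash (a i) x).val = some j) is key := by
  induction is generalizing key with
  | nil => simp [keyFrom, eq_comm]
  | cons i is ih =>
    rw [keyFrom, List.forall₂_cons_left_iff]
    simp only [Timed.bind_val]
    cases h : (CloseTop1.hash (a i) x).val with
    | none => simp
    | some j =>
      simp only [Timed.bind_val, Timed.pure_val, Option.map_eq_some_iff, ih, Option.some.injEq]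
      constructor
      · rintro ⟨k, h1, rfl⟩
        exact ⟨j, k, rfl, h1, rfl⟩
      · rintro ⟨_, k, rfl, h1, rfl⟩
        exact ⟨k, h1, rfl⟩

lemma keyFrom_time_le (a : Fin t → Fin m → E d) (x : E d) (is : List (Fin t)) :
    (keyFrom a x is).time ≤ is.length * (m * (2 * d + 2) + 1) := by
  induction is with
  | nil => simp [keyFrom]
  | cons i is ih =>
    rw [keyFrom]
    simp only [Timed.bind_time, tick_time, List.length_cons]
    have := CloseTop1.hash_time_le (a i) x
    cases h : (CloseTop1.hash (a i) x).val with
    | none => simp only [Timed.pure_time]; nlinarith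
    | some j => simp only [Timed.pure_time, Timed.bind_time]; nlinarith

lemma length_of_keyFrom_val (a : Fin t → Fin m → E d) (x : E d) (key : List (Fin m))
    (h : (keyFrom a x (List.finRange t)).val = some key) : key.length = t := by
  simpa using ((keyFrom_val_eq_some a x _ key).1 h).length_eq.symm

/-- The records of the points of a list. -/
noncomputable def recordsOf (a : Fin t → Fin m → E d) (xs : List (E d)) :
    List (List (Fin m) × E d) :=
  xs.filterMap fun x => (keyFrom a x (List.finRange t)).val.map fun key => (key, x)

lemma insertAll_records (a : Fin t → Fin m → E d) (H : HashTable m d) (xs : List (E d)) :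
    (insertAll a H xs).val.records = (recordsOf a xs).reverse ++ H.records := by
  induction xs generalizing H with
  | nil => simp [insertAll, recordsOf]
  | cons x xs ih =>
    rw [insertAll]
    simp only [Timed.bind_val]
    cases h : (keyFrom a x (List.finRange t)).val with
    | none => simp [ih, recordsOf, h]
    | some key => simp [ih, recordsOf, h, HashTable.insert]

lemma insertAll_time_le (a : Fin t → Fin m → E d) (H : HashTable m d) (xs : List (E d)) :
    (insertAll a H xs).time ≤ xs.length * (t * (m * (2 * d + 2) + 1) + t + d + 2) := by
  induction xs generalizing H with
  | nil => simp [insertAll]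
  | cons x xs ih =>
    rw [insertAll]
    simp only [Timed.bind_time, tick_time, List.length_cons]
    have h1 := keyFrom_time_le a x (List.finRange t)
    rw [List.length_finRange] at h1
    cases h : (keyFrom a x (List.finRange t)).val with
    | none =>
      have := ih H
      simp only
      nlinarith
    | some key =>
      have h2 := length_of_keyFrom_val a x key h
      have := ih (H.insert key x).val
      simp only [Timed.bind_time]
      have h3 : (H.insert key x).time = t + d + 1 := by simp [HashTable.insert, h2]
      nlinarith

lemma searchFrom_val (D : TensorCloseTop1 d t m) (q : E d) (is : List (Fin t)) :
    (D.searchFrom q is).val = is.map fun i => (CloseTop1.search D.η (D.vectors i) q).val := by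
  induction is with
  | nil => rfl
  | cons i is ih => simp [searchFrom, ih]

lemma searchFrom_time (D : TensorCloseTop1 d t m) (q : E d) (is : List (Fin t)) :
    (D.searchFrom q is).time = is.length * (m * (2 * d + 2) + 1) := by
  induction is with
  | nil => simp [searchFrom]
  | cons i is ih =>
    simp only [searchFrom, Timed.bind_time, CloseTop1.search_time, tick_time, Timed.pure_time,
      List.length_cons, ih]
    ring

lemma buckets_val (D : TensorCloseTop1 d t m) (q : E d) :
    (D.buckets q).val = ((List.finRange t).map fun i =>
      (CloseTop1.search D.η (D.vectors i) q).val).sections := by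
  simp [buckets, searchFrom_val]

lemma buckets_time (D : TensorCloseTop1 d t m) (q : E d) :
    (D.buckets q).time = t * (m * (2 * d + 2) + 1) + t * (D.numBuckets q + 1) := by
  simp [buckets, searchFrom_time, numBuckets]

open Classical in
-- As a product over independent structures, the count has an expectation that is a `t`-th power.
lemma numBuckets_eq (D : TensorCloseTop1 d t m) (q : E d) :
    D.numBuckets q
      = ∏ i, ∑ j, if D.η ≤ inner ℝ (D.vectors i j) q then 1 else 0 := by
  rw [numBuckets, buckets_val, length_sections, List.map_map, Finset.prod_eq_multiset_prod]
  change _ = (Multiset.map _ (List.finRange t : Multiset (Fin t))).prod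
  rw [Multiset.map_coe, Multiset.prod_coe]
  congr 1
  refine List.map_congr_left fun i _ => ?_
  rw [Function.comp_apply, CloseTop1.search_val, Finset.sum_boole, ← List.countP_eq_length_filter]
  simp only [Nat.cast_id]
  rw [Finset.card_filter, Finset.sum_eq_multiset_sum]
  change _ = (Multiset.map _ (List.finRange m : Multiset (Fin m))).sum
  rw [Multiset.map_coe, Multiset.sum_coe]
  induction List.finRange m with
  | nil => simp
  | cons j js ih => simp [List.countP_cons, ih, add_comm]

lemma length_of_mem_buckets (D : TensorCloseTop1 d t m) (q : E d) {key : List (Fin m)}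
    (h : key ∈ (D.buckets q).val) : key.length = t := by
  rw [buckets_val] at h
  simpa using List.mem_sections_length h

lemma mem_buckets (D : TensorCloseTop1 d t m) (q : E d) {key : List (Fin m)} :
    key ∈ (D.buckets q).val ↔
      List.Forall₂ (fun j i => D.η ≤ inner ℝ (D.vectors i j) q) key (List.finRange t) := by
  classical
  rw [buckets_val, List.mem_sections, List.forall₂_map_right_iff]
  simp [CloseTop1.search_val]

lemma count_buckets_le_one (D : TensorCloseTop1 d t m) (q : E d) (key : List (Fin m)) :
    (D.buckets q).val.count key ≤ 1 := by
  rw [buckets_val]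
  refine count_sections_le_one ?_ key
  simp only [List.mem_map, forall_exists_index, and_imp]
  rintro _ i _ rfl
  rw [CloseTop1.search_val]
  exact (List.nodup_finRange m).filter _

lemma scanBucket_cons (β : ℝ) (q x : E d) (xs : List (E d)) :
    scanBucket β q (x :: xs) = tick (2 * d) >>= fun _ => tick 1 >>= fun _ =>
      if β ≤ inner ℝ q x then pure (some x) else scanBucket β q xs := rfl

open Classical in
lemma scanBucket_val (β : ℝ) (q : E d) (xs : List (E d)) :
    (scanBucket β q xs).val = xs.find? fun x => β ≤ inner ℝ q x := by
  induction xs with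
  | nil => rfl
  | cons x xs ih =>
    rw [scanBucket_cons, List.find?_cons]
    by_cases h : β ≤ inner ℝ q x
    · simp [h]
    · simp only [Timed.bind_val, if_neg h, ih, decide_eq_false h]

open Classical in
-- Each point passed over is far, and the scan stops at the first other one. Charging that last
-- point only on success makes the total over all buckets contain it once, not once per bucket.
lemma scanBucket_time_le (β : ℝ) (q : E d) (xs : List (E d)) :
    (scanBucket β q xs).time ≤ (2 * d + 1) *
      (xs.countP (fun y => inner ℝ q y < β) + if (scanBucket β q xs).val.isSome then 1 else 0) := by
  induction xs with
  | nil => simp [scanBucket]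
  | cons x xs ih =>
    rw [scanBucket_cons]
    by_cases h : β ≤ inner ℝ q x
    · simp only [Timed.bind_val, Timed.bind_time, tick_time, if_pos h,
        Timed.pure_val, Timed.pure_time, Option.isSome_some, if_true]
      nlinarith [Nat.zero_le ((x :: xs).countP (fun y => inner ℝ q y < β))]
    · simp only [Timed.bind_val, Timed.bind_time, tick_time, if_neg h]
      rw [List.countP_cons_of_pos (by simpa using h)]
      nlinarith

open Classical in
lemma scanBuckets_val (D : TensorCloseTop1 d t m) (q : E d) (keys : List (List (Fin m))) :
    (D.scanBuckets q keys).val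
      = (keys.flatMap D.table.bucket).find? fun x => D.β ≤ inner ℝ q x := by
  induction keys with
  | nil => rfl
  | cons key keys ih =>
    rw [scanBuckets, List.flatMap_cons, List.find?_append, ← scanBucket_val, ← ih]
    simp only [Timed.bind_val, HashTable.lookup, Timed.pure_val]
    cases (scanBucket D.β q (D.table.bucket key)).val <;> simp

open Classical in
lemma scanBuckets_time_le (D : TensorCloseTop1 d t m) (q : E d) (keys : List (List (Fin m)))
    (hk : ∀ key ∈ keys, key.length = t) :
    (D.scanBuckets q keys).time ≤ keys.length * (t + 1) + (2 * d + 1) *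
      ((keys.flatMap D.table.bucket).countP (fun y => inner ℝ q y < D.β) + 1) := by
  induction keys with
  | nil => simp [scanBuckets]
  | cons key keys ih =>
    have ih := ih fun k h => hk k (by simp [h])
    have h1 := scanBucket_time_le D.β q (D.table.bucket key)
    have h2 := hk key (by simp)
    rw [scanBuckets, List.flatMap_cons, List.countP_append]
    simp only [Timed.bind_val, Timed.bind_time, HashTable.lookup, Timed.pure_val, tick_time,
      Timed.pure_time, h2, List.length_cons]
    cases h : (scanBucket D.β q (D.table.bucket key)).val with
    | none =>
      simp only [h, Option.isSome_none, Bool.false_eq_true, if_false] at h1 ⊢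
      nlinarith
    | some x =>
      simp only [h, Option.isSome_some, if_true, Timed.pure_time] at h1 ⊢
      nlinarith [Nat.zero_le (keys.length * (t + 1)), Nat.zero_le ((2 * d + 1) *
        (keys.flatMap D.table.bucket).countP (fun y => inner ℝ q y < D.β))]

lemma query_time_le (D : TensorCloseTop1 d t m) (q : E d) :
    (D.query q).time ≤ t * (m * (2 * d + 2) + 1) + t * (D.numBuckets q + 1) +
      (D.numBuckets q * (t + 1) + (2 * d + 1) * (D.numFar q + 1)) := by
  classical
  have h := D.scanBuckets_time_le q (D.buckets q).val fun _ => D.length_of_mem_buckets q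
  simp only [query, Timed.bind_time, buckets_time]
  refine Nat.add_le_add_left (h.trans (le_of_eq ?_)) _
  simp only [numBuckets, numFar, inspected]

open Classical in
lemma query_val (D : TensorCloseTop1 d t m) (q : E d) :
    (D.query q).val = (D.inspected q).find? fun x => D.β ≤ inner ℝ q x :=
  D.scanBuckets_val q _

lemma mem_inspected (D : TensorCloseTop1 d t m) (q y : E d) :
    y ∈ D.inspected q ↔ ∃ key ∈ (D.buckets q).val, (key, y) ∈ D.table.records := by
  simp only [inspected, List.mem_flatMap, HashTable.bucket, List.mem_map, List.mem_filter]
  simp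

/-- Double counting: the sum over buckets becomes a sum over records, each weighted by the
multiplicity of its address. -/
lemma countP_flatMap_bucket (p : E d → Bool)
    (keys : List (List (Fin m))) (R : List (List (Fin m) × E d)) :
    (keys.flatMap (HashTable.mk R).bucket).countP p
      = (R.map fun r => if p r.2 then keys.count r.1 else 0).sum := by
  induction keys with
  | nil => simp
  | cons key keys ih =>
    rw [List.flatMap_cons, List.countP_append, ih, HashTable.bucket]
    simp only
    clear ih
    induction R with
    | nil => simp
    | cons r R ih =>
      simp only [List.map_cons, List.sum_cons, List.filter_cons, List.count_cons] at ih ⊢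
      rw [← ih]
      by_cases h : r.1 = key
      · by_cases hp : p r.2 <;> simp [h, hp] <;> ring
      · have h' : ¬ key = r.1 := fun e => h e.symm
        by_cases hp : p r.2 <;> simp [h, h', hp] <;> ring

variable {n : ℕ} (α β : ℝ) (x : Fin n → E d)

lemma construct_records (a : Fin (levels n α) → Fin (filters n α β) → E d) :
    (construct α β x a).val.table.records = (recordsOf a (List.ofFn x)).reverse := by
  simp [construct, insertAll_records, HashTable.empty]

lemma construct_time_le (a : Fin (levels n α) → Fin (filters n α β) → E d) :
    (construct α β x a).time ≤ 64 + levels n α * filters n α β * d +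
      n * (levels n α * (filters n α β * (2 * d + 2) + 1) + levels n α + d + 2) := by
  have := insertAll_time_le a (HashTable.empty (filters n α β) d) (List.ofFn x)
  rw [List.length_ofFn] at this
  simp only [construct, Timed.bind_time, tick_time, Timed.pure_time]
  lia

lemma construct_space_le (a : Fin (levels n α) → Fin (filters n α β) → E d) :
    (construct α β x a).val.space ≤ levels n α * filters n α β * d + n * (d + 3) + 4 := by
  have h : (recordsOf a (List.ofFn x)).length ≤ n := by
    refine (List.length_filterMap_le _ _).trans ?_
    simp
  rw [space, construct_records, List.length_reverse]
  gcongr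

lemma mem_construct_inspected (a : Fin (levels n α) → Fin (filters n α β) → E d) (q y : E d) :
    y ∈ (construct α β x a).val.inspected q ↔ y ∈ Set.range x ∧
      ∃ key, (keyFrom a y (List.finRange _)).val = some key ∧
        key ∈ ((construct α β x a).val.buckets q).val := by
  rw [mem_inspected, construct_records]
  simp only [List.mem_reverse, recordsOf, List.mem_filterMap, List.mem_ofFn, Option.map_eq_some_iff,
    Prod.mk.injEq]
  constructor
  · rintro ⟨key, h1, z, h2, key', h3, rfl, rfl⟩
    exact ⟨h2, key', h3, h1⟩
  · rintro ⟨h2, key, h3, h1⟩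
    exact ⟨key, h1, y, h2, key, h3, rfl, rfl⟩

/-- The vectors of one structure that lead the query to the bucket of `y`. -/
def Collides (η : ℝ) (q y : E d) (b : Fin m → E d) : Prop :=
  ∃ j, (CloseTop1.hash b y).val = some j ∧ η ≤ inner ℝ (b j) q

/-- Both conditions on the key are coordinatewise, so it can be chosen one structure at a time.
Being inspected thus becomes an intersection of independent events. -/
lemma exists_key_iff (a : Fin (levels n α) → Fin (filters n α β) → E d) (q y : E d) :
    (∃ key, (keyFrom a y (List.finRange _)).val = some key ∧
        key ∈ ((construct α β x a).val.buckets q).val) ↔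
      ∀ i, Collides (threshold α (filters n α β)) q y (a i) := by
  simp only [keyFrom_val_eq_some, mem_buckets]
  change (∃ key, _ ∧ List.Forall₂ (fun j i => threshold α (filters n α β) ≤ inner ℝ (a i j) q) _ _)
    ↔ _
  constructor
  · rintro ⟨key, h1, h2⟩ i
    rw [List.forall₂_iff_get] at h1 h2
    have h3 := h1.2 i (by simp) (by simp [← h1.1])
    have h4 := h2.2 i (by simp [← h1.1]) (by simp)
    exact ⟨_, by simpa using h3, by simpa using h4⟩
  · intro h
    choose f hf using h
    refine ⟨(List.finRange _).map f, ?_, ?_⟩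
    · rw [List.forall₂_map_right_iff, List.forall₂_same]
      exact fun i _ => (hf i).1
    · rw [List.forall₂_map_left_iff, List.forall₂_same]
      exact fun i _ => (hf i).2

lemma mem_construct_inspected_iff (a : Fin (levels n α) → Fin (filters n α β) → E d) (q : E d)
    (k : Fin n) : x k ∈ (construct α β x a).val.inspected q ↔
      ∀ i, Collides (threshold α (filters n α β)) q (x k) (a i) := by
  rw [mem_construct_inspected, exists_key_iff]
  simp

open Classical in
lemma construct_numFar_le (a : Fin (levels n α) → Fin (filters n α β) → E d) (q : E d) :
    (construct α β x a).val.numFar q ≤ ∑ k, if inner ℝ q (x k) < β ∧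
      ∀ i, Collides (threshold α (filters n α β)) q (x k) (a i) then 1 else 0 := by
  set D := (construct α β x a).val with hD
  have h1 : D.table = ⟨(recordsOf a (List.ofFn x)).reverse⟩ := by
    rw [← construct_records α β x a]
  rw [numFar, inspected, h1, countP_flatMap_bucket, List.map_reverse, List.sum_reverse, recordsOf]
  -- The induction runs over an arbitrary list while `D`, and with it the list of inspected buckets,
  -- stays fixed.
  have h3 : ∀ xs : List (E d), ((xs.filterMap fun x =>
      (keyFrom a x (List.finRange _)).val.map fun key => (key, x)).map fun r =>
        if (decide (inner ℝ q r.2 < D.β) : Bool) = true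
          then (D.buckets q).val.count r.1 else 0).sum ≤
      (xs.map fun y => if inner ℝ q y < β ∧
        ∀ i, Collides (threshold α (filters n α β)) q y (a i) then 1 else 0).sum := by
    intro xs
    induction xs with
    | nil => simp
    | cons y ys ih =>
      cases h : (keyFrom a y (List.finRange _)).val with
      | none =>
        rw [List.filterMap_cons_none (by simp [h]), List.map_cons, List.sum_cons]
        exact ih.trans (Nat.le_add_left _ _)
      | some key =>
        rw [List.filterMap_cons_some (b := (key, y)) (by simp [h])]
        simp only [List.map_cons, List.sum_cons]
        refine Nat.add_le_add ?_ ih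
        have hβ : D.β = β := rfl
        by_cases hy : inner ℝ q y < β
        · by_cases hk : key ∈ (D.buckets q).val
          · have := (exists_key_iff α β x a q y).1 ⟨key, h, hk⟩
            simp only [hβ, hy, decide_true, if_true, true_and, if_pos this]
            exact count_buckets_le_one D q key
          · simp [List.count_eq_zero_of_not_mem hk]
        · simp [hβ, hy]
  refine (le_trans (le_of_eq ?_) (h3 (List.ofFn x))).trans (le_of_eq ?_)
  · congr
  · rw [List.map_ofFn, List.sum_ofFn]
    rfl

/-- The query succeeds as soon as one close point is inspected. -/
lemma isNearNeighbor_of_mem_inspected (a : Fin (levels n α) → Fin (filters n α β) → E d) (q : E d)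
    (k : Fin n) (hk : β ≤ inner ℝ q (x k)) (h : x k ∈ (construct α β x a).val.inspected q) :
    IsNearNeighbor β x q ((construct α β x a).val.query q).val := by
  classical
  rw [query_val]
  cases hf : List.find? (fun y => decide ((construct α β x a).val.β ≤ inner ℝ q y))
      ((construct α β x a).val.inspected q) with
  | none =>
    exact absurd (decide_eq_true hk) (List.find?_eq_none.1 hf _ h)
  | some y =>
    have h1 := List.mem_of_find?_eq_some hf
    have h2 := List.find?_some hf
    rw [mem_construct_inspected] at h1
    obtain ⟨⟨i, rfl⟩, -⟩ := h1
    exact ⟨i, rfl, of_decide_eq_true h2⟩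

end TensorCloseTop1

/-! ### Product measures -/

section Product

variable {ι Ω : Type*} [Fintype ι] [MeasurableSpace Ω] (μ : Measure Ω) [IsProbabilityMeasure μ]

lemma lintegral_pi_prod (f : Ω → ℝ≥0∞) (hf : Measurable f) :
    ∫⁻ a, ∏ i : ι, f (a i) ∂(Measure.pi fun _ => μ) = (∫⁻ b, f b ∂μ) ^ Fintype.card ι := by
  rw [lintegral_prod_eq_prod_lintegral_of_indepFun Finset.univ (fun i (a : ι → Ω) => f (a i))
    (iIndepFun_pi (μ := fun _ => μ) (X := fun _ => f) fun _ => hf.aemeasurable)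
    (fun i => hf.comp (measurable_pi_apply i))]
  have (i : ι) : ∫⁻ a : ι → Ω, f (a i) ∂(Measure.pi fun _ => μ) = ∫⁻ b, f b ∂μ :=
    (measurePreserving_eval (fun _ => μ) i).lintegral_comp hf
  simp [this]

lemma pi_setOf_eval (i : ι) (s : Set Ω) : (Measure.pi fun _ : ι => μ) {a | a i ∈ s} = μ s := by
  classical
  have : {a : ι → Ω | a i ∈ s} = Set.pi Set.univ (fun j => if j = i then s else Set.univ) := by
    ext a
    simp only [Set.mem_ofPred_eq, Set.mem_pi, Set.mem_univ, true_imp_iff]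
    constructor
    · intro h j
      split_ifs with hj
      · rwa [hj]
      · trivial
    · intro h
      simpa using h i
  rw [this, Measure.pi_pi, Finset.prod_eq_single i]
  · simp
  · intro j _ hj
    simp [hj]
  · simp

lemma pi_setOf_forall (s : Set Ω) :
    (Measure.pi fun _ : ι => μ) {a | ∀ i, a i ∈ s} = μ s ^ Fintype.card ι := by
  have : {a : ι → Ω | ∀ i, a i ∈ s} = Set.pi Set.univ (fun _ => s) := by
    ext a; simp
  rw [this, Measure.pi_pi]
  simp

lemma pi_setOf_exists_le (s : Set Ω) :
    (Measure.pi fun _ : ι => μ) {a | ∃ i, a i ∈ s} ≤ Fintype.card ι * μ s := by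
  rw [Set.ofPred_exists]
  refine (measure_iUnion_fintype_le _ _).trans ?_
  simp [pi_setOf_eval]

/-- If the conditional probability of `G` given `B` is at most `e`, then the first of `m`
independent samples that lies in `B` lies in `G` with probability at most `e`. -/
lemma pi_setOf_first_le {m : ℕ} {B G : Set Ω} (hB : MeasurableSet B) {e : ℝ≥0∞}
    (he : μ (B ∩ G) ≤ μ B * e) :
    (Measure.pi fun _ : Fin m => μ) {a | ∃ j, (∀ k < j, a k ∉ B) ∧ a j ∈ B ∩ G} ≤ e := by
  have h1 (j : Fin m) : (Measure.pi fun _ : Fin m => μ) {a | (∀ k < j, a k ∉ B) ∧ a j ∈ B ∩ G}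
      = (1 - μ B) ^ (j : ℕ) * μ (B ∩ G) := by
    have : {a : Fin m → Ω | (∀ k < j, a k ∉ B) ∧ a j ∈ B ∩ G} = Set.pi Set.univ
        (fun k => if k < j then Bᶜ else if k = j then B ∩ G else Set.univ) := by
      ext a
      simp only [Set.mem_ofPred_eq, Set.mem_pi, Set.mem_univ, true_imp_iff]
      constructor
      · rintro ⟨h1, h2⟩ k
        split_ifs with h3 h4
        · exact h1 k h3
        · rwa [h4]
        · trivial
      · intro h
        refine ⟨fun k hk => by simpa [hk] using h k, by simpa using h j⟩
    rw [this, Measure.pi_pi]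
    have h2 (k : Fin m) : μ (if k < j then Bᶜ else if k = j then B ∩ G else Set.univ)
        = (if k < j then 1 - μ B else 1) * (if k = j then μ (B ∩ G) else 1) := by
      rcases lt_trichotomy k j with h | h | h
      · simp [h, h.ne, prob_compl_eq_one_sub hB]
      · simp [h]
      · simp [h.not_gt, h.ne']
    simp_rw [h2]
    rw [Finset.prod_mul_distrib, Finset.prod_ite_eq' Finset.univ j, Finset.prod_ite]
    simp only [Finset.prod_const, Finset.mem_univ, if_true]
    rw [one_pow, mul_one, ← Fin.card_Iio j]
    congr 3
    ext k
    simp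
  rw [Set.ofPred_exists]
  calc _ ≤ ∑ j : Fin m, (1 - μ B) ^ (j : ℕ) * (μ B * e) := by
        refine (measure_iUnion_fintype_le _ _).trans (Finset.sum_le_sum fun j _ => ?_)
        rw [h1 j]
        gcongr
    _ = (∑ j ∈ Finset.range m, (1 - μ B) ^ j) * (μ B * e) := by
        rw [Finset.sum_range, Finset.sum_mul]
    _ ≤ (∑' j, (1 - μ B) ^ j) * (μ B * e) := by
        gcongr
        exact ENNReal.sum_le_tsum _
    _ = (μ B)⁻¹ * μ B * e := by
        rw [ENNReal.tsum_geometric, ENNReal.sub_sub_cancel ENNReal.one_ne_top prob_le_one,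
          mul_assoc]
    -- An inequality, since for `μ B = 0` the product `(μ B)⁻¹ * μ B` is `0` in `ℝ≥0∞`.
    _ ≤ 1 * e := by
        gcongr
        exact ENNReal.inv_mul_le_one _
    _ = e := one_mul e

end Product

/-! ### Collision probabilities and expected counts -/

lemma measurableSet_band {d : ℕ} (m : ℕ) (x : E d) : MeasurableSet (band m x) :=
  (measurable_inner_left x) measurableSet_Icc

lemma measurableSet_le_inner {d : ℕ} (η : ℝ) (q : E d) :
    MeasurableSet {a : E d | η ≤ inner ℝ a q} :=
  (measurable_inner_left q) measurableSet_Ici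

namespace CloseTop1

variable {d m : ℕ}

lemma hash_eq_some {a : Fin m → E d} {x : E d} {j : Fin m} (h : (hash a x).val = some j) :
    a j ∈ band m x ∧ ∀ k < j, a k ∉ band m x := by
  classical
  rw [hash_val, List.find?_eq_some_iff_append] at h
  obtain ⟨h1, as, bs, h2, h3⟩ := h
  refine ⟨of_decide_eq_true h1, fun k hk => ?_⟩
  have h4 := List.pairwise_lt_finRange m
  have h5 := List.mem_finRange k
  rw [h2] at h4 h5
  rw [List.pairwise_append, List.pairwise_cons] at h4
  rcases List.mem_append.1 h5 with h6 | h6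
  · simpa using h3 k h6
  · rcases List.mem_cons.1 h6 with rfl | h6
    · exact absurd hk (lt_irrefl _)
    · exact absurd hk (h4.2.1.1 k h6).not_gt

lemma hash_eq_none {a : Fin m → E d} {x : E d} (h : (hash a x).val = none) (j : Fin m) :
    a j ∉ band m x := by
  classical
  rw [hash_val, List.find?_eq_none] at h
  simpa using h j (List.mem_finRange j)

end CloseTop1

namespace TensorCloseTop1

variable {d t m : ℕ}

/-- Forgetting that the hash is the first index in the band makes a union bound over `j` available.
-/
lemma setOf_collides_subset (η : ℝ) (q y : E d) :
    {b : Fin m → E d | Collides η q y b} ⊆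
      {b | ∃ j, b j ∈ band m y ∩ {a | η ≤ inner ℝ a q}} :=
  fun _ ⟨j, h1, h2⟩ => ⟨j, (CloseTop1.hash_eq_some h1).1, h2⟩

lemma setOf_not_collides_subset (η : ℝ) (q y : E d) :
    {b : Fin m → E d | ¬ Collides η q y b} ⊆ {b | ∀ j, b j ∈ (band m y)ᶜ} ∪
      {b | ∃ j, (∀ k < j, b k ∉ band m y) ∧ b j ∈ band m y ∩ {a | inner ℝ a q < η}} := by
  intro b (hb : ¬ Collides η q y b)
  cases h : (CloseTop1.hash b y).val with
  | none => exact Or.inl (CloseTop1.hash_eq_none h)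
  | some j =>
    refine Or.inr ⟨j, (CloseTop1.hash_eq_some h).2, (CloseTop1.hash_eq_some h).1, ?_⟩
    exact lt_of_not_ge fun h' => hb ⟨j, h, h'⟩

instance (d t m : ℕ) : IsProbabilityMeasure (gaussians d t m) := by
  unfold gaussians
  infer_instance

/-- The probability that the query misses the bucket of `y`. -/
lemma gaussians_not_collides_le (η : ℝ) (q y : E d) {e : ℝ≥0∞}
    (he : stdGaussian (E d) (band m y ∩ {a | inner ℝ a q < η})
      ≤ stdGaussian (E d) (band m y) * e) :
    gaussians d t m {a | ¬ ∀ i, Collides η q y (a i)}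
      ≤ t * ((1 - stdGaussian (E d) (band m y)) ^ m + e) := by
  have h1 : {a : Fin t → Fin m → E d | ¬ ∀ i, Collides η q y (a i)}
      = {a | ∃ i, a i ∈ {b | ¬ Collides η q y b}} := by
    ext a; simp
  rw [h1, gaussians]
  refine (pi_setOf_exists_le _ _).trans ?_
  rw [Fintype.card_fin]
  gcongr
  refine (measure_mono (setOf_not_collides_subset η q y)).trans ((measure_union_le _ _).trans ?_)
  gcongr
  · rw [pi_setOf_forall, prob_compl_eq_one_sub (measurableSet_band m y), Fintype.card_fin]
  · exact pi_setOf_first_le _ (measurableSet_band m y) he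

lemma numBuckets_eq_indicator (D : TensorCloseTop1 d t m) (q : E d) :
    (D.numBuckets q : ℝ≥0∞) = ∏ i, (fun b : Fin m → E d =>
      ∑ j, {b : E d | D.η ≤ inner ℝ b q}.indicator 1 (b j)) (D.vectors i) := by
  classical
  rw [numBuckets_eq]
  push_cast
  simp [Set.indicator_apply]

lemma measurable_indicator_le_inner (η : ℝ) (q : E d) (j : Fin m) : Measurable
    fun b : Fin m → E d => {b : E d | η ≤ inner ℝ b q}.indicator (1 : E d → ℝ≥0∞) (b j) :=
  (measurable_one.indicator (measurableSet_le_inner η q)).comp (measurable_pi_apply j)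

lemma measurable_numBuckets {D : (Fin t → Fin m → E d) → TensorCloseTop1 d t m} {η : ℝ}
    (hD : ∀ a, (D a).η = η ∧ (D a).vectors = a) (q : E d) :
    Measurable fun a => ((D a).numBuckets q : ℝ≥0∞) := by
  simp_rw [numBuckets_eq_indicator, fun a => (hD a).1, fun a => (hD a).2]
  exact Finset.measurable_prod _ fun i _ => (Finset.measurable_sum _ fun j _ =>
    measurable_indicator_le_inner η q j).comp (measurable_pi_apply i)

/-- The expected number of buckets. -/
lemma lintegral_numBuckets {D : (Fin t → Fin m → E d) → TensorCloseTop1 d t m} {η : ℝ}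
    (hD : ∀ a, (D a).η = η ∧ (D a).vectors = a) (q : E d) :
    ∫⁻ a, ((D a).numBuckets q : ℝ≥0∞) ∂(gaussians d t m)
      = (m * stdGaussian (E d) {a | η ≤ inner ℝ a q}) ^ t := by
  simp_rw [numBuckets_eq_indicator, fun a => (hD a).1, fun a => (hD a).2]
  rw [gaussians, lintegral_pi_prod _ _ (Finset.measurable_sum _ fun j _ =>
    measurable_indicator_le_inner η q j), Fintype.card_fin,
    lintegral_finsetSum _ fun j _ => measurable_indicator_le_inner η q j]
  congr 1
  have h3 (j : Fin m) : ∫⁻ b : Fin m → E d, {b : E d | η ≤ inner ℝ b q}.indicator 1 (b j)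
      ∂(Measure.pi fun _ => stdGaussian (E d)) = stdGaussian (E d) {a | η ≤ inner ℝ a q} := by
    rw [(measurePreserving_eval (fun _ => stdGaussian (E d)) j).lintegral_comp
      (measurable_one.indicator (measurableSet_le_inner η q)),
      lintegral_indicator_one (measurableSet_le_inner η q)]
  simp [h3]

variable {n : ℕ} (α β : ℝ) (x : Fin n → E d)

/-- Inspection of a far point is enlarged to the measurable event that every structure has some
vector in its band and above the threshold. The union bound gives `m p` per structure and
independence the power, so measurability of `numFar` is not needed. -/
lemma lintegral_construct_numFar_le (q : E d) {p : ℝ≥0∞}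
    (hp : ∀ k, inner ℝ q (x k) < β → stdGaussian (E d) (band (filters n α β) (x k) ∩
      {a | threshold α (filters n α β) ≤ inner ℝ a q}) ≤ p) :
    ∫⁻ a, ((construct α β x a).val.numFar q : ℝ≥0∞) ∂(gaussians d (levels n α) (filters n α β))
      ≤ n * (filters n α β * p) ^ levels n α := by
  classical
  set t := levels n α
  set m := filters n α β
  set η := threshold α m
  let S (k : Fin n) : Set (E d) := band m (x k) ∩ {a | η ≤ inner ℝ a q}
  have hS (k : Fin n) : MeasurableSet {a : Fin t → Fin m → E d | ∀ i, ∃ j, a i j ∈ S k} := by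
    have := (measurableSet_band m (x k)).inter (measurableSet_le_inner η q)
    simp only [Set.ofPred_forall, Set.ofPred_exists]
    refine MeasurableSet.iInter fun i => MeasurableSet.iUnion fun j => ?_
    exact ((measurable_pi_apply j).comp (measurable_pi_apply i)) this
  let T (k : Fin n) : Set (Fin t → Fin m → E d) :=
    if inner ℝ q (x k) < β then {a | ∀ i, ∃ j, a i j ∈ S k} else ∅
  have hT (k : Fin n) : MeasurableSet (T k) := by
    dsimp only [T]
    split_ifs
    · exact hS k
    · exact MeasurableSet.empty
  calc _ ≤ ∫⁻ a, ∑ k, (T k).indicator 1 a ∂(gaussians d t m) := by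
        refine lintegral_mono fun a => ?_
        refine (Nat.cast_le.2 (construct_numFar_le α β x a q)).trans ?_
        push_cast
        refine Finset.sum_le_sum fun k _ => ?_
        split_ifs with h
        · rw [Set.indicator_of_mem]
          · simp
          · simp only [T, if_pos h.1]
            exact fun i => setOf_collides_subset _ _ _ (h.2 i)
        · exact zero_le
    _ = ∑ k, gaussians d t m (T k) := by
        rw [lintegral_finsetSum _ fun k _ => measurable_one.indicator (hT k)]
        simp [hT]
    _ ≤ ∑ _k : Fin n, (m * p) ^ t := by
        refine Finset.sum_le_sum fun k _ => ?_
        by_cases h : inner ℝ q (x k) < β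
        · simp only [T, if_pos h]
          have := pi_setOf_forall (ι := Fin t) (Measure.pi fun _ : Fin m => stdGaussian (E d))
            {b | ∃ j, b j ∈ S k}
          rw [gaussians]
          refine this.le.trans ?_
          rw [Fintype.card_fin]
          gcongr
          refine (pi_setOf_exists_le _ _).trans ?_
          rw [Fintype.card_fin]
          gcongr
          exact hp k h
        · simp [T, h]
    _ = n * (m * p) ^ t := by simp

end TensorCloseTop1

/-! ### Estimates for the parameters -/

/-- The parameters for a large `n`, in terms of `s = log^{1/32} n`. -/
structure Regime (n : ℕ) (α β s : ℝ) : Prop where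
  β_pos : 0 < β
  β_lt : β < α
  α_lt : α < 1
  log_eq : Real.log n = s ^ 32
  le_s : 4 ≤ s
  log_le : Real.log (s ^ 32) ≤ s
  gap : 1 ≤ (1 - α ^ 2) * s ^ 24

lemma rho_le_one {α β : ℝ} (hβ : 0 < β) (hβα : β < α) (hα : α < 1) : rho α β ≤ 1 := by
  have : 0 < 1 - α * β := by nlinarith
  rw [rho, div_le_one (by positivity)]
  nlinarith [sq_nonneg (α - β)]

/-- The factor `σ = (1 - β²) / (1 - αβ)²` of the exponent. -/
noncomputable def sigma (α β : ℝ) : ℝ := (1 - β ^ 2) / (1 - α * β) ^ 2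

lemma rho_eq (α β : ℝ) : rho α β = (1 - α ^ 2) * sigma α β := by
  rw [rho, sigma, mul_div_assoc]

lemma one_le_sigma {α β : ℝ} (hβ : 0 < β) (hβα : β < α) (hα : α < 1) : 1 ≤ sigma α β := by
  have h1 : 0 < 1 - α * β := by nlinarith
  rw [sigma, one_le_div (by positivity)]
  have h2 : 1 - α * β ≤ 1 := by nlinarith
  have h3 : 1 - α * β ≤ 1 - β ^ 2 := by nlinarith
  nlinarith

/-- `1 - ρ = (α - β)² / (1 - αβ)²`. -/
lemma one_sub_rho {α β : ℝ} (hβ : 0 < β) (hβα : β < α) (hα : α < 1) :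
    (1 - rho α β) * (1 - β ^ 2) = (α - β) ^ 2 * sigma α β := by
  have h1 : 0 < 1 - α * β := by nlinarith
  rw [rho, sigma]
  field_simp
  ring

namespace Regime

variable {n : ℕ} {α β s : ℝ}

lemma s_pos (h : Regime n α β s) : 0 < s := by linarith [h.le_s]

lemma one_le_pow (h : Regime n α β s) (k : ℕ) : 1 ≤ s ^ k :=
  one_le_pow₀ (by linarith [h.le_s])

lemma pow_le_pow (h : Regime n α β s) {k l : ℕ} (hkl : k ≤ l) : s ^ k ≤ s ^ l :=
  pow_le_pow_right₀ (by linarith [h.le_s]) hkl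

lemma n_pos (h : Regime n α β s) : 0 < (n : ℝ) := by
  rcases Nat.eq_zero_or_pos n with h0 | h0
  · have := h.log_eq
    rw [h0] at this
    simp only [Nat.cast_zero, Real.log_zero] at this
    linarith [h.one_le_pow 32]
  · exact_mod_cast h0

lemma n_eq (h : Regime n α β s) : (n : ℝ) = Real.exp (s ^ 32) := by
  rw [← h.log_eq, Real.exp_log h.n_pos]

lemma α_pos (h : Regime n α β s) : 0 < α := h.β_pos.trans h.β_lt

lemma gap_pos (h : Regime n α β s) : 0 < 1 - α ^ 2 := by nlinarith [h.α_pos, h.α_lt]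

lemma gap_le_one (_h : Regime n α β s) : 1 - α ^ 2 ≤ 1 := by nlinarith

lemma β_gap (h : Regime n α β s) : 1 - α ^ 2 ≤ 1 - β ^ 2 := by nlinarith [h.β_pos, h.β_lt]

lemma one_le_sigma (h : Regime n α β s) : 1 ≤ sigma α β :=
  TensorANN.one_le_sigma h.β_pos h.β_lt h.α_lt

lemma rho_nonneg (h : Regime n α β s) : 0 ≤ rho α β := by
  rw [rho_eq]
  exact mul_nonneg h.gap_pos.le (zero_le_one.trans h.one_le_sigma)

lemma rho_le_one (h : Regime n α β s) : rho α β ≤ 1 :=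
  TensorANN.rho_le_one h.β_pos h.β_lt h.α_lt

lemma levels_eq (h : Regime n α β s) : levels n α = ⌈s ^ 4 / (1 - α ^ 2)⌉₊ := by
  rw [levels, h.log_eq, ← Real.rpow_natCast s 32, ← Real.rpow_mul h.s_pos.le]
  norm_num

lemma le_levels_mul (h : Regime n α β s) : s ^ 4 ≤ levels n α * (1 - α ^ 2) := by
  rw [← div_le_iff₀ h.gap_pos, h.levels_eq]
  exact Nat.le_ceil _

lemma levels_mul_le (h : Regime n α β s) : levels n α * (1 - α ^ 2) ≤ 2 * s ^ 4 := by
  have h1 := (Nat.ceil_lt_add_one (a := s ^ 4 / (1 - α ^ 2))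
    (div_nonneg (by have := h.s_pos; positivity) h.gap_pos.le)).le
  rw [← h.levels_eq] at h1
  have h2 := mul_le_mul_of_nonneg_right h1 h.gap_pos.le
  have h3 : (s ^ 4 / (1 - α ^ 2) + 1) * (1 - α ^ 2) = s ^ 4 + (1 - α ^ 2) := by
    have := h.gap_pos.ne'
    field_simp
  linarith [h.one_le_pow 4, h.gap_le_one]

lemma levels_le (h : Regime n α β s) : (levels n α : ℝ) ≤ 2 * s ^ 28 := by
  have h1 := h.levels_mul_le
  have h2 := mul_le_mul_of_nonneg_left h.gap (Nat.cast_nonneg (α := ℝ) (levels n α))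
  have h3 := mul_le_mul_of_nonneg_right h1 (pow_pos h.s_pos 24).le
  nlinarith

lemma one_le_levels (h : Regime n α β s) : (1 : ℝ) ≤ levels n α := by
  have h1 := h.le_levels_mul
  have h2 := mul_le_mul_of_nonneg_left h.gap_le_one (Nat.cast_nonneg (α := ℝ) (levels n α))
  linarith [h.one_le_pow 4]

lemma sigma_le (h : Regime n α β s) : sigma α β ≤ s ^ 24 := by
  have h1 := h.rho_le_one
  rw [rho_eq] at h1
  have h2 := mul_le_mul_of_nonneg_left h.gap (zero_le_one.trans h.one_le_sigma)
  have h3 := mul_le_mul_of_nonneg_right h1 (pow_pos h.s_pos 24).le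
  nlinarith

lemma filters_eq (h : Regime n α β s) :
    filters n α β = ⌈Real.exp (s ^ 32 * sigma α β / levels n α)⌉₊ := by
  rw [filters, Real.rpow_def_of_pos h.n_pos, h.log_eq]
  congr 2
  rw [sigma]
  ring

lemma filters_pos (h : Regime n α β s) : 0 < (filters n α β : ℝ) := by
  rw [h.filters_eq]
  exact_mod_cast Nat.ceil_pos.2 (Real.exp_pos _)

/-- With `log_filters_le` this says `t log m = σ log n` up to `t`, the price of rounding `m` up. -/
lemma le_log_filters (h : Regime n α β s) :
    s ^ 32 * sigma α β ≤ levels n α * Real.log (filters n α β) := by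
  have h1 : s ^ 32 * sigma α β / levels n α ≤ Real.log (filters n α β) := by
    rw [Real.le_log_iff_exp_le h.filters_pos, h.filters_eq]
    exact Nat.le_ceil _
  rw [div_le_iff₀ (by linarith [h.one_le_levels])] at h1
  linarith

lemma log_filters_le (h : Regime n α β s) :
    levels n α * Real.log (filters n α β) ≤ s ^ 32 * sigma α β + levels n α := by
  have ht : (0 : ℝ) < levels n α := by linarith [h.one_le_levels]
  have h0 : 0 ≤ s ^ 32 * sigma α β / levels n α :=
    div_nonneg (mul_nonneg (pow_pos h.s_pos _).le (zero_le_one.trans h.one_le_sigma)) ht.le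
  have h1 : Real.log (filters n α β) ≤ s ^ 32 * sigma α β / levels n α + 1 := by
    rw [Real.log_le_iff_le_exp h.filters_pos, h.filters_eq, Real.exp_add]
    refine (Nat.ceil_lt_add_one (Real.exp_pos _).le).le.trans ?_
    have := Real.add_one_le_exp (1 : ℝ)
    have := Real.one_le_exp h0
    nlinarith
  have h2 := mul_le_mul_of_nonneg_left h1 ht.le
  rwa [mul_add, mul_div_cancel₀ _ ht.ne', mul_one] at h2

lemma exp_log_filters (h : Regime n α β s) :
    Real.exp (Real.log (filters n α β)) = filters n α β := Real.exp_log h.filters_pos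

lemma le_log_filters' (h : Regime n α β s) : s ^ 4 / 2 ≤ Real.log (filters n α β) := by
  have ht : (0 : ℝ) < levels n α := by linarith [h.one_le_levels]
  have h1 := h.le_log_filters
  have h2 : s ^ 4 / 2 * levels n α ≤ s ^ 32 := by
    have := mul_le_mul_of_nonneg_left h.levels_le (pow_pos h.s_pos 4).le
    nlinarith
  have h3 := mul_le_mul_of_nonneg_left h.one_le_sigma (pow_pos h.s_pos 32).le
  refine le_of_mul_le_mul_left ?_ ht
  linarith

lemma le_log_filters_const (h : Regime n α β s) : 128 ≤ Real.log (filters n α β) := by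
  have h1 : (4 : ℝ) ^ 4 ≤ s ^ 4 := pow_le_pow_left₀ (by norm_num) h.le_s 4
  linarith [h.le_log_filters']

/-- A large `σ` is compensated by a large `t`: since `t (1 - α²) ≥ s⁴` and `(1 - α²) σ ≤ 1`, one has
`s³² σ ≤ t s²⁸`. -/
lemma log_filters_le' (h : Regime n α β s) : Real.log (filters n α β) ≤ 2 * s ^ 28 := by
  have ht : (0 : ℝ) < levels n α := by linarith [h.one_le_levels]
  have h1 := h.log_filters_le
  have h2 : s ^ 32 * sigma α β ≤ levels n α * s ^ 28 := by
    have h3 := h.rho_le_one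
    rw [rho_eq] at h3
    have hσ := zero_le_one.trans h.one_le_sigma
    have h4 := mul_le_mul_of_nonneg_left h.le_levels_mul
      (mul_nonneg (pow_pos h.s_pos 28).le hσ)
    have h5 : (0 : ℝ) ≤ levels n α * s ^ 28 := mul_nonneg ht.le (pow_pos h.s_pos 28).le
    have h6 := mul_le_mul_of_nonneg_left h3 h5
    nlinarith
  have h3 := mul_le_mul_of_nonneg_left (h.one_le_pow 28) ht.le
  refine le_of_mul_le_mul_left ?_ ht
  nlinarith

lemma loglog_le (h : Regime n α β s) : Real.log (Real.log (filters n α β)) ≤ s := by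
  refine (Real.log_le_log (by linarith [h.le_log_filters_const]) ?_).trans h.log_le
  refine h.log_filters_le'.trans ?_
  have h1 : (4 : ℝ) ^ 4 ≤ s ^ 4 := pow_le_pow_left₀ (by norm_num) h.le_s 4
  have := mul_le_mul_of_nonneg_left h1 (pow_pos h.s_pos 28).le
  nlinarith [pow_pos h.s_pos 28]

lemma one_le_loglog (h : Regime n α β s) : 1 ≤ Real.log (Real.log (filters n α β)) := by
  rw [Real.le_log_iff_exp_le (by linarith [h.le_log_filters_const])]
  linarith [Real.exp_one_lt_d9, h.le_log_filters_const]

/-- The bound `3 s³¹` for the square roots that occur in the exponents. -/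
lemma sqrt_bound (h : Regime n α β s) {X : ℝ} (hX : X ^ 2 ≤ 6 * s ^ 61) : X ≤ 3 * s ^ 31 := by
  have h1 := h.pow_le_pow (show 61 ≤ 62 by norm_num)
  have h2 : X ^ 2 ≤ (3 * s ^ 31) ^ 2 := by nlinarith
  exact le_of_sq_le_sq h2 (mul_nonneg (by norm_num) (pow_pos h.s_pos 31).le)

end Regime

/-! ### The thresholds -/

section Thresholds

variable {m : ℕ} {α β : ℝ}

lemma bandUpper_sq (hM : 0 ≤ Real.log m) : bandUpper m ^ 2 = 2 * Real.log m :=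
  Real.sq_sqrt (by linarith)

lemma bandUpper_pos (hM : 0 < Real.log m) : 0 < bandUpper m :=
  Real.sqrt_pos.2 (by linarith)

lemma bandLower_eq (m : ℕ) :
    bandLower m = bandUpper m - 3 / 2 * (Real.log (Real.log m) / bandUpper m) := rfl

lemma threshold_eq (α : ℝ) (m : ℕ) : threshold α m
    = α * bandUpper m - √(2 * (1 - α ^ 2) * Real.log (Real.log m)) := rfl

lemma bandUpper_mul_sqrt (hM : 0 ≤ Real.log m) (α : ℝ) :
    bandUpper m * √(2 * (1 - α ^ 2) * Real.log (Real.log m))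
      = 2 * √((1 - α ^ 2) * (Real.log m * Real.log (Real.log m))) := by
  rw [bandUpper, ← Real.sqrt_mul (by linarith)]
  have : 2 * Real.log m * (2 * (1 - α ^ 2) * Real.log (Real.log m))
      = 2 ^ 2 * ((1 - α ^ 2) * (Real.log m * Real.log (Real.log m))) := by ring
  rw [this, Real.sqrt_mul (by norm_num), Real.sqrt_sq (by norm_num)]

lemma bandLower_nonneg (hM : 0 < Real.log m) : 0 ≤ bandLower m := by
  have hu := bandUpper_pos hM
  have h1 := bandUpper_sq hM.le
  have h2 := Real.log_le_sub_one_of_pos hM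
  rw [bandLower_eq, sub_nonneg, ← mul_div_assoc, div_le_iff₀ hu, ← sq, h1]
  linarith

lemma le_bandLower_sq (hM : 0 < Real.log m) :
    Real.log m - 3 / 2 * Real.log (Real.log m) ≤ bandLower m ^ 2 / 2 := by
  have hu := bandUpper_pos hM
  have h1 := bandUpper_sq hM.le
  have h2 : bandLower m ^ 2 = bandUpper m ^ 2 - 3 * Real.log (Real.log m)
      + (3 / 2 * (Real.log (Real.log m) / bandUpper m)) ^ 2 := by
    rw [bandLower_eq]
    field_simp
    ring
  nlinarith [sq_nonneg (3 / 2 * (Real.log (Real.log m) / bandUpper m))]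

lemma stdGaussian_threshold_le {d : ℕ} {q : E d} (hq : ‖q‖ = 1) (hα0 : 0 < α) (hα1 : α < 1)
    (hM : 0 < Real.log m) :
    stdGaussian (E d) {a | threshold α m ≤ inner ℝ a q} ≤ ENNReal.ofReal (Real.exp
      (-(α ^ 2 * Real.log m)
        + 2 * √((1 - α ^ 2) * (Real.log m * Real.log (Real.log m))))) := by
  set r := √(2 * (1 - α ^ 2) * Real.log (Real.log m)) with hr
  have hr0 : 0 ≤ r := Real.sqrt_nonneg _
  have hu := bandUpper_pos hM
  have h1 := bandUpper_sq hM.le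
  have h2 := bandUpper_mul_sqrt hM.le α
  rw [← hr] at h2
  have h3 : threshold α m = α * bandUpper m - r := threshold_eq α m
  have h4 : 0 ≤ (1 - α) * (bandUpper m * r) := by
    have : 0 ≤ 1 - α := by linarith
    positivity
  rcases le_total 0 (threshold α m) with h | h
  · refine (stdGaussian_tail q one_pos (by rw [hq]; norm_num) h).trans
      (ENNReal.ofReal_le_ofReal (Real.exp_le_exp.2 ?_))
    rw [h3]
    nlinarith
  -- A nonpositive threshold means `α u ≤ r`, where `u` is `bandUpper m`. Then the claimed exponent
  -- is nonnegative and the bound is trivial.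
  · refine prob_le_one.trans ?_
    rw [← ENNReal.ofReal_one]
    refine ENNReal.ofReal_le_ofReal (Real.one_le_exp ?_)
    rw [h3] at h
    have h5 : α * bandUpper m * (α * bandUpper m) ≤ r * (α * bandUpper m) := by
      gcongr
      linarith
    nlinarith

lemma stdGaussian_band_inter_threshold_le {d : ℕ} {x q : E d} (hx : ‖x‖ = 1) (hq : ‖q‖ = 1)
    (hβ : 0 < β) (hβα : β < α) (hα : α < 1) (hM : 0 < Real.log m) (hc : inner ℝ q x ≤ β) :
    stdGaussian (E d) (band m x ∩ {a | threshold α m ≤ inner ℝ a q}) ≤ ENNReal.ofReal (Real.exp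
      (-(Real.log m - 3 / 2 * Real.log (Real.log m)) - ((α - β) ^ 2 * Real.log m - 2 * ((α - β) *
        √((1 - α ^ 2) * (Real.log m * Real.log (Real.log m))))) / (1 - β ^ 2))) := by
  set r := √(2 * (1 - α ^ 2) * Real.log (Real.log m)) with hr
  have hr0 : 0 ≤ r := Real.sqrt_nonneg _
  have hu := bandUpper_pos hM
  have hlo := bandLower_nonneg hM
  have h1 := bandUpper_sq hM.le
  have h2 := bandUpper_mul_sqrt hM.le α
  rw [← hr] at h2
  have h3 : threshold α m = α * bandUpper m - r := threshold_eq α m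
  have h4 := le_bandLower_sq hM
  have hb : 0 < 1 - β ^ 2 := by nlinarith
  have hg : 0 < α - β := by linarith
  rcases le_total (β * bandUpper m) (threshold α m) with h | h
  · refine (stdGaussian_band_inter_le hx hq hβ (hβα.trans hα) hlo hu.le hc h ?_).trans
      (ENNReal.ofReal_le_ofReal (Real.exp_le_exp.2 ?_))
    · rw [h3]
      nlinarith
    · have h5 : ((α - β) ^ 2 * Real.log m - 2 * ((α - β) *
          √((1 - α ^ 2) * (Real.log m * Real.log (Real.log m))))) / (1 - β ^ 2)
          ≤ (threshold α m - β * bandUpper m) ^ 2 / (2 * (1 - β ^ 2)) := by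
        rw [div_le_div_iff₀ hb (by positivity), h3]
        have : 2 * ((α - β) ^ 2 * Real.log m - 2 * ((α - β) *
            √((1 - α ^ 2) * (Real.log m * Real.log (Real.log m)))))
            ≤ (α * bandUpper m - r - β * bandUpper m) ^ 2 := by nlinarith [sq_nonneg r]
        nlinarith
      linarith
  -- If `η ≤ β u` the query condition yields no gain, but the claimed gain is then nonpositive too,
  -- so the tail of the band alone suffices.
  · have h0 : (band m x ∩ {a | threshold α m ≤ inner ℝ a q})
        ⊆ {a | bandLower m ≤ inner ℝ a x} := fun a ha => ha.1.1
    refine (measure_mono h0).trans ((stdGaussian_tail x one_pos (by rw [hx]; norm_num) hlo).trans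
      (ENNReal.ofReal_le_ofReal (Real.exp_le_exp.2 ?_)))
    rw [h3] at h
    have h5 : (α - β) * ((α - β) * bandUpper m * bandUpper m)
        ≤ (α - β) * (r * bandUpper m) := by
      gcongr
      linarith
    have h6 : ((α - β) ^ 2 * Real.log m - 2 * ((α - β) *
          √((1 - α ^ 2) * (Real.log m * Real.log (Real.log m))))) / (1 - β ^ 2) ≤ 0 := by
      refine div_nonpos_of_nonpos_of_nonneg ?_ hb.le
      nlinarith [Real.sqrt_nonneg ((1 - α ^ 2) * (Real.log m * Real.log (Real.log m)))]
    linarith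

/-- The constant in the lower bound for the mass of the storing interval. -/
noncomputable def bandConst : ℝ := (√2)⁻¹ * (√(2 * Real.pi))⁻¹ * Real.exp (-2)

lemma bandConst_pos : 0 < bandConst := by
  unfold bandConst
  positivity

/-- In a window of width `1 / u`, of order `M^(-1/2)`, at the lower end of the band the density is
at least of order `M^(3/2) / m`. The coefficient `3/2` in `bandLower` is what leaves the factor `M`
in `M / m`. -/
lemma le_stdGaussian_band_mul {d : ℕ} {x : E d} (hx : ‖x‖ = 1) (hm : 0 < (m : ℝ))
    (hM : 0 < Real.log m) (hl : 1 ≤ Real.log (Real.log m))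
    (hl' : Real.log (Real.log m) ^ 2 ≤ Real.log m) :
    ENNReal.ofReal (bandConst * Real.log m / m) ≤ stdGaussian (E d) (band m x) := by
  have hu := bandUpper_pos hM
  have h1 := bandUpper_sq hM.le
  set ℓ := Real.log (Real.log m) with hℓ
  have e1 : bandLower m + (bandUpper m)⁻¹ = bandUpper m - (3 / 2 * ℓ - 1) / bandUpper m := by
    rw [bandLower_eq]
    field_simp
    ring
  have h2 : 0 ≤ (3 / 2 * ℓ - 1) / bandUpper m := div_nonneg (by linarith) hu.le
  refine le_trans (ENNReal.ofReal_le_ofReal ?_) (le_stdGaussian_band hx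
    (w := (bandUpper m)⁻¹) (bandLower_nonneg hM) (by linarith))
  have h3 : (bandLower m + (bandUpper m)⁻¹) ^ 2 / 2 ≤ Real.log m - 3 / 2 * ℓ + 2 := by
    have e2 : (bandLower m + (bandUpper m)⁻¹) ^ 2
        = bandUpper m ^ 2 - 2 * (3 / 2 * ℓ - 1) + (3 / 2 * ℓ - 1) ^ 2 / bandUpper m ^ 2 := by
      rw [e1]
      field_simp
      ring
    have h4 : (3 / 2 * ℓ - 1) ^ 2 / bandUpper m ^ 2 ≤ 2 := by
      rw [h1, div_le_iff₀ (by linarith)]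
      nlinarith
    rw [h1] at h4
    rw [e2, h1]
    linarith
  have e3 : bandConst * Real.log m / m = (bandUpper m)⁻¹ * ((√(2 * Real.pi))⁻¹ *
      Real.exp (-(Real.log m - 3 / 2 * ℓ + 2))) := by
    have e4 : Real.exp (-(Real.log m - 3 / 2 * ℓ + 2))
        = (m : ℝ)⁻¹ * (Real.log m * √(Real.log m)) * Real.exp (-2) := by
      have e5 : Real.exp (ℓ / 2) = √(Real.log m) := by
        rw [hℓ, Real.exp_half, Real.exp_log hM]
      have e6 : -(Real.log m - 3 / 2 * ℓ + 2) = -Real.log m + (ℓ + ℓ / 2) + (-2) := by ring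
      rw [e6, Real.exp_add, Real.exp_add, Real.exp_add, e5, Real.exp_neg, Real.exp_log hm, hℓ,
        Real.exp_log hM]
    have h5 : 0 < √(Real.log m) := Real.sqrt_pos.2 hM
    rw [e4, bandConst, bandUpper, Real.sqrt_mul (by norm_num : (0 : ℝ) ≤ 2) (Real.log m)]
    field_simp
  rw [e3]
  gcongr

lemma one_sub_stdGaussian_band_pow_le {d : ℕ} {x : E d} (hx : ‖x‖ = 1) (hm : 0 < (m : ℝ))
    (hM : 0 < Real.log m) (hl : 1 ≤ Real.log (Real.log m))
    (hl' : Real.log (Real.log m) ^ 2 ≤ Real.log m) :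
    (1 - stdGaussian (E d) (band m x)) ^ m
      ≤ ENNReal.ofReal (Real.exp (-(bandConst * Real.log m))) := by
  have h0 : 0 ≤ bandConst * Real.log m / m := by
    have := bandConst_pos
    positivity
  calc (1 - stdGaussian (E d) (band m x)) ^ m
      ≤ (ENNReal.ofReal (Real.exp (-(bandConst * Real.log m / m)))) ^ m := by
        gcongr
        refine (tsub_le_tsub_left (le_stdGaussian_band_mul hx hm hM hl hl') 1).trans ?_
        rw [← ENNReal.ofReal_one, ← ENNReal.ofReal_sub _ h0]
        refine ENNReal.ofReal_le_ofReal ?_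
        linarith [Real.add_one_le_exp (-(bandConst * Real.log m / m))]
    _ = _ := by
        rw [← ENNReal.ofReal_pow (Real.exp_pos _).le, ← Real.exp_nat_mul]
        congr 2
        field_simp

/-- The margin is `r - α w`, with `w` the width of the band. The offset `r` is chosen so that `r² /
(2 (1 - α²)) = ℓ`. The cross term costs at most `1`, because `hl'` amounts to `r w ≤ 1 - α²`; hence
`exp (1 - ℓ) = e / M`. -/
lemma stdGaussian_band_inter_lt_threshold_le {d : ℕ} {x q : E d} (hx : ‖x‖ = 1) (hq : ‖q‖ = 1)
    (hα0 : 0 < α) (hα1 : α < 1) (hc : α ≤ inner ℝ q x)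
    (hM : 0 < Real.log m) (hl : 1 ≤ Real.log (Real.log m))
    (hl' : 9 * Real.log (Real.log m) ^ 3 ≤ 4 * ((1 - α ^ 2) * Real.log m)) :
    stdGaussian (E d) (band m x ∩ {a | inner ℝ a q < threshold α m})
      ≤ stdGaussian (E d) (band m x) * ENNReal.ofReal (Real.exp 1 / Real.log m) := by
  have hu := bandUpper_pos hM
  have h1 := bandUpper_sq hM.le
  set ℓ := Real.log (Real.log m) with hℓ
  have ha : 0 < 1 - α ^ 2 := by nlinarith
  set r := √(2 * (1 - α ^ 2) * ℓ) with hr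
  have hr2 : r ^ 2 = 2 * (1 - α ^ 2) * ℓ := Real.sq_sqrt (by positivity)
  have hr0 : 0 ≤ r := Real.sqrt_nonneg _
  set w := 3 / 2 * (ℓ / bandUpper m) with hw
  have hw0 : 0 ≤ w := by positivity
  have hwu : w * bandUpper m = 3 / 2 * ℓ := by
    rw [hw]
    field_simp
  have e1 : α * bandLower m - threshold α m = r - α * w := by
    rw [bandLower_eq, threshold_eq]
    ring
  have hrw : r * w ≤ 1 - α ^ 2 := by
    have h2 : r * w * bandUpper m = r * (3 / 2 * ℓ) := by rw [mul_assoc, hwu]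
    refine le_of_mul_le_mul_right (a := bandUpper m) ?_ hu
    rw [h2]
    refine abs_le_of_sq_le_sq' ?_ (by positivity) |>.2
    have e3 : (r * (3 / 2 * ℓ)) ^ 2 = (1 - α ^ 2) * (9 * ℓ ^ 3) / 2 := by
      rw [mul_pow, hr2]; ring
    have e4 : ((1 - α ^ 2) * bandUpper m) ^ 2
        = (1 - α ^ 2) * (4 * ((1 - α ^ 2) * Real.log m)) / 2 := by
      rw [mul_pow, h1]; ring
    rw [e3, e4]
    gcongr
  have hαw : α * w ≤ w := mul_le_of_le_one_left hw0 hα1.le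
  have hwr : w ≤ r := by
    have h3 : r * w ≤ r * r := by nlinarith
    have hrpos : 0 < r := Real.sqrt_pos.2 (by positivity)
    exact le_of_mul_le_mul_left h3 hrpos
  refine (stdGaussian_band_inter_lt_le hx hq hα0 hα1 (bandLower_nonneg hM) hc
    (by linarith)).trans ?_
  refine mul_le_mul' le_rfl (ENNReal.ofReal_le_ofReal ?_)
  have e5 : Real.exp 1 / Real.log m = Real.exp (1 - ℓ) := by
    rw [Real.exp_sub, hℓ, Real.exp_log hM]
  rw [e5, Real.exp_le_exp, e1]
  have h4 : ℓ - 1 ≤ (r - α * w) ^ 2 / (2 * (1 - α ^ 2)) := by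
    rw [le_div_iff₀ (by positivity)]
    have h5 : r * (α * w) ≤ 1 - α ^ 2 := (mul_le_mul_of_nonneg_left hαw hr0).trans hrw
    nlinarith [sq_nonneg (α * w)]
  linarith

end Thresholds

namespace Regime

variable {n d : ℕ} {α β s : ℝ}

/-! ### Bounds for a large `n` -/

lemma log_filters_pos (h : Regime n α β s) : 0 < Real.log (filters n α β) := by
  linarith [h.le_log_filters_const]

lemma levels_mul_log_le (h : Regime n α β s) :
    levels n α * Real.log (filters n α β) ≤ 3 * s ^ 56 := by
  have h1 := mul_le_mul_of_nonneg_left h.sigma_le (pow_pos h.s_pos 32).le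
  have h2 := h.pow_le_pow (show 28 ≤ 56 by norm_num)
  nlinarith [h.log_filters_le, h.levels_le]

/-- The main term is `(1 - α²) t M`, which is at most `ρ log n + 2 s⁴`. The error is controlled by
grouping its square as `(t (1 - α²)) (t M) ℓ ≤ 2 s⁴ · 3 s⁵⁶ · s`. -/
lemma buckets_exponent (h : Regime n α β s) :
    levels n α * (Real.log (filters n α β) + (-(α ^ 2 * Real.log (filters n α β)) +
      2 * √((1 - α ^ 2) * (Real.log (filters n α β) * Real.log (Real.log (filters n α β))))))
      ≤ rho α β * s ^ 32 + 8 * s ^ 31 := by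
  have h1 := h.log_filters_le
  have h2 := h.levels_mul_log_le
  have h3 := h.levels_mul_le
  have hl := h.loglog_le
  have hl0 := h.one_le_loglog
  have hM := h.log_filters_pos
  have ht := h.one_le_levels
  have ha := h.gap_pos
  have hs := h.s_pos
  set M := Real.log (filters n α β)
  set ℓ := Real.log M
  set t : ℝ := (levels n α : ℝ)
  have h4 : t * √((1 - α ^ 2) * (M * ℓ)) ≤ 3 * s ^ 31 := by
    refine h.sqrt_bound ?_
    rw [mul_pow, Real.sq_sqrt (by positivity)]
    calc t ^ 2 * ((1 - α ^ 2) * (M * ℓ)) = (t * (1 - α ^ 2)) * (t * M) * ℓ := by ring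
      _ ≤ (2 * s ^ 4) * (3 * s ^ 56) * s := by gcongr
      _ = 6 * s ^ 61 := by ring
  have h5 := mul_le_mul_of_nonneg_left h1 ha.le
  have h6 := h.pow_le_pow (show 4 ≤ 31 by norm_num)
  rw [rho_eq]
  nlinarith

lemma lintegral_numBuckets_le (h : Regime n α β s) (x : Fin n → E d) {q : E d} (hq : ‖q‖ = 1) :
    ∫⁻ a, ((TensorCloseTop1.construct α β x a).val.numBuckets q : ℝ≥0∞)
      ∂(gaussians d (levels n α) (filters n α β))
      ≤ ENNReal.ofReal (Real.exp (rho α β * s ^ 32 + 8 * s ^ 31)) := by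
  rw [TensorCloseTop1.lintegral_numBuckets (D := fun a => (TensorCloseTop1.construct α β x a).val)
    (η := threshold α (filters n α β)) (fun a => ⟨rfl, rfl⟩) q]
  refine (pow_le_pow_left' (mul_le_mul' le_rfl (stdGaussian_threshold_le hq h.α_pos h.α_lt
    h.log_filters_pos)) _).trans ?_
  rw [← ENNReal.ofReal_natCast, ← ENNReal.ofReal_mul (Nat.cast_nonneg _),
    ← ENNReal.ofReal_pow (mul_nonneg (Nat.cast_nonneg _) (Real.exp_pos _).le)]
  refine ENNReal.ofReal_le_ofReal ?_
  nth_rewrite 1 [← h.exp_log_filters]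
  rw [← Real.exp_add, ← Real.exp_nat_mul, Real.exp_le_exp]
  exact h.buckets_exponent

lemma far_exponent (h : Regime n α β s) :
    levels n α * (Real.log (filters n α β) + (-(Real.log (filters n α β) -
      3 / 2 * Real.log (Real.log (filters n α β))) -
      ((α - β) ^ 2 * Real.log (filters n α β) - 2 * ((α - β) *
        √((1 - α ^ 2) * (Real.log (filters n α β) * Real.log (Real.log (filters n α β))))))
        / (1 - β ^ 2)))
      ≤ (rho α β - 1) * s ^ 32 + 9 * s ^ 31 := by
  have h0 := h.le_log_filters
  have h1 := h.log_filters_le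
  have ht' := h.levels_le
  have hl := h.loglog_le
  have hl0 := h.one_le_loglog
  have hM := h.log_filters_pos
  have ht := h.one_le_levels
  have ha := h.gap_pos
  have hab := h.β_gap
  have hs := h.s_pos
  have hσ := h.one_le_sigma
  have hρ := h.rho_nonneg
  have hg : 0 < α - β := by linarith [h.β_lt]
  have hid := one_sub_rho h.β_pos h.β_lt h.α_lt
  set M := Real.log (filters n α β)
  set ℓ := Real.log M
  set t : ℝ := (levels n α : ℝ)
  set b := 1 - β ^ 2
  set σ := sigma α β
  have hb : 0 < b := by linarith
  set R := √((1 - α ^ 2) * (M * ℓ)) with hR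
  have hR2 : R ^ 2 = (1 - α ^ 2) * (M * ℓ) := Real.sq_sqrt (by positivity)
  have hR0 : 0 ≤ R := Real.sqrt_nonneg _
  have h2 : (1 - rho α β) * s ^ 32 ≤ t * ((α - β) ^ 2 * M) / b := by
    rw [le_div_iff₀ hb]
    have := mul_le_mul_of_nonneg_left h0 (sq_nonneg (α - β))
    linear_combination this + s ^ 32 * hid
  have h3 : t * (α - β) * R / b ≤ 3 * s ^ 31 := by
    refine h.sqrt_bound ?_
    have h4 : t * M ≤ σ * (3 * s ^ 32) := by
      have h5 := h.pow_le_pow (show 28 ≤ 32 by norm_num)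
      nlinarith [pow_pos hs 32]
    -- The denominator `b²` is absorbed by two factors: `1 - α² ≤ b`, and `(α - β)² σ = (1 - ρ) b ≤
    -- b`, which also takes care of a large `σ`.
    have h5 : (α - β) ^ 2 * σ ≤ b := by
      rw [← hid]
      exact mul_le_of_le_one_left hb.le (by linarith)
    rw [div_pow, div_le_iff₀ (by positivity)]
    calc (t * (α - β) * R) ^ 2 = (α - β) ^ 2 * t * (1 - α ^ 2) * (t * M) * ℓ := by
          rw [mul_pow, hR2]; ring
      _ ≤ (α - β) ^ 2 * (2 * s ^ 28) * b * (σ * (3 * s ^ 32)) * s := by gcongr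
      _ = ((α - β) ^ 2 * σ) * (6 * s ^ 61 * b) := by ring
      _ ≤ b * (6 * s ^ 61 * b) := by gcongr
      _ = 6 * s ^ 61 * b ^ 2 := by ring
  have h6 : t * ℓ ≤ 2 * s ^ 29 := by
    calc t * ℓ ≤ 2 * s ^ 28 * s := by gcongr
      _ = 2 * s ^ 29 := by ring
  have h7 := h.pow_le_pow (show 29 ≤ 31 by norm_num)
  have e1 : t * (M + (-(M - 3 / 2 * ℓ) - ((α - β) ^ 2 * M - 2 * ((α - β) * R)) / b))
      = 3 / 2 * (t * ℓ) - t * ((α - β) ^ 2 * M) / b + 2 * (t * (α - β) * R / b) := by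
    field_simp
    ring
  rw [e1]
  linarith

lemma lintegral_numFar_le (h : Regime n α β s) {x : Fin n → E d} (hx : ∀ i, ‖x i‖ = 1) {q : E d}
    (hq : ‖q‖ = 1) :
    ∫⁻ a, ((TensorCloseTop1.construct α β x a).val.numFar q : ℝ≥0∞)
      ∂(gaussians d (levels n α) (filters n α β))
      ≤ ENNReal.ofReal (Real.exp (rho α β * s ^ 32 + 9 * s ^ 31)) := by
  refine (TensorCloseTop1.lintegral_construct_numFar_le α β x q fun k hk =>
    stdGaussian_band_inter_threshold_le (hx k) hq h.β_pos h.β_lt h.α_lt h.log_filters_pos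
      hk.le).trans ?_
  rw [← ENNReal.ofReal_natCast, ← ENNReal.ofReal_natCast, ← ENNReal.ofReal_mul (Nat.cast_nonneg _),
    ← ENNReal.ofReal_pow (mul_nonneg (Nat.cast_nonneg _) (Real.exp_pos _).le),
    ← ENNReal.ofReal_mul (Nat.cast_nonneg _)]
  refine ENNReal.ofReal_le_ofReal ?_
  nth_rewrite 1 [h.n_eq]
  nth_rewrite 1 [← h.exp_log_filters]
  rw [← Real.exp_add, ← Real.exp_nat_mul, ← Real.exp_add, Real.exp_le_exp]
  linarith [h.far_exponent]

lemma levels_le_exp (h : Regime n α β s) : (levels n α : ℝ) ≤ Real.exp (2 * s ^ 28) := by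
  linarith [h.levels_le, Real.add_one_le_exp (2 * s ^ 28)]

lemma filters_le_exp (h : Regime n α β s) : (filters n α β : ℝ) ≤ Real.exp (2 * s ^ 28) := by
  rw [← Real.log_le_iff_le_exp h.filters_pos]
  exact h.log_filters_le'

lemma one_le_filters (h : Regime n α β s) : (1 : ℝ) ≤ filters n α β := by
  have : 0 < filters n α β := by exact_mod_cast h.filters_pos
  exact_mod_cast this

lemma one_le_n (h : Regime n α β s) : (1 : ℝ) ≤ n := by
  have : 0 < n := by exact_mod_cast h.n_pos
  exact_mod_cast this

lemma levels_mul_filters_le (h : Regime n α β s) :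
    (levels n α : ℝ) * filters n α β ≤ Real.exp (4 * s ^ 28) := by
  refine (mul_le_mul h.levels_le_exp h.filters_le_exp (Nat.cast_nonneg _)
    (Real.exp_pos _).le).trans (le_of_eq ?_)
  rw [← Real.exp_add]
  ring_nf

/-- This fixes `ε = 100 / s`. The constant `100` is generous: it absorbs the error `9 s³¹`, the
factor `t m ≤ exp (4 s²⁸)` and numerical constants such as `74 ≤ exp 74`. -/
lemma rpow_eq (h : Regime n α β s) (r : ℝ) :
    (n : ℝ) ^ (r + 100 / s) = Real.exp (r * s ^ 32 + 100 * s ^ 31) := by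
  rw [Real.rpow_def_of_pos h.n_pos, h.log_eq]
  congr 1
  have := h.s_pos.ne'
  field_simp

lemma construct_space_le (h : Regime n α β s) (hd : 1 ≤ d) (x : Fin n → E d)
    (a : Fin (levels n α) → Fin (filters n α β) → E d) :
    ((TensorCloseTop1.construct α β x a).val.space : ℝ) ≤ 9 * (d * n) := by
  have h1 : ((TensorCloseTop1.construct α β x a).val.space : ℝ) ≤ _ :=
    Nat.cast_le.2 (TensorCloseTop1.construct_space_le α β x a)
  push_cast at h1
  have h2 : (levels n α : ℝ) * filters n α β ≤ n := by
    refine h.levels_mul_filters_le.trans ?_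
    rw [h.n_eq, Real.exp_le_exp]
    have h1 : (4 : ℝ) ^ 4 ≤ s ^ 4 := pow_le_pow_left₀ (by norm_num) h.le_s 4
    have := mul_le_mul_of_nonneg_left h1 (pow_pos h.s_pos 28).le
    nlinarith [pow_pos h.s_pos 28]
  have hn := h.one_le_n
  have hd' : (1 : ℝ) ≤ d := by exact_mod_cast hd
  have h3 := mul_le_mul_of_nonneg_right h2 (Nat.cast_nonneg (α := ℝ) d)
  nlinarith

lemma construct_time_le (h : Regime n α β s) (hd : 1 ≤ d) (x : Fin n → E d)
    (a : Fin (levels n α) → Fin (filters n α β) → E d) :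
    ((TensorCloseTop1.construct α β x a).time : ℝ) ≤ d * (n : ℝ) ^ (1 + 100 / s) := by
  have h1 : ((TensorCloseTop1.construct α β x a).time : ℝ) ≤ _ :=
    Nat.cast_le.2 (TensorCloseTop1.construct_time_le α β x a)
  push_cast at h1
  have hn := h.one_le_n
  have hd' : (1 : ℝ) ≤ d := by exact_mod_cast hd
  have ht := h.one_le_levels
  have hm := h.one_le_filters
  have htm := h.levels_mul_filters_le
  set t : ℝ := (levels n α : ℝ)
  set m : ℝ := (filters n α β : ℝ)
  have hc (u : ℝ) (hu : 1 ≤ u) (v : ℝ) (hv : 1 ≤ v) : 1 ≤ u * v :=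
    one_le_mul_of_one_le_of_one_le hu hv
  have htm1 := hc t ht m hm
  have h2 : 64 + t * m * d + n * (t * (m * (2 * d + 2) + 1) + t + d + 2)
      ≤ 74 * (d * (n * (t * m))) := by
    have e1 : t ≤ t * m := le_mul_of_one_le_right (by linarith) hm
    have e2 : t * m ≤ t * m * d := le_mul_of_one_le_right (by linarith) hd'
    have e3 : (d : ℝ) ≤ t * m * d := le_mul_of_one_le_left (by linarith) htm1
    have e4 : t * m * d ≤ n * (t * m * d) := le_mul_of_one_le_left (by linarith) hn
    have e5 : t * (m * (2 * d + 2) + 1) + t + d + 2 ≤ 9 * (t * m * d) := by nlinarith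
    have e6 := mul_le_mul_of_nonneg_left e5 (by linarith : (0 : ℝ) ≤ n)
    nlinarith
  refine h1.trans (h2.trans ?_)
  rw [h.rpow_eq, mul_left_comm]
  refine mul_le_mul_of_nonneg_left ?_ (by linarith)
  have h74 : (74 : ℝ) ≤ Real.exp 74 := by linarith [Real.add_one_le_exp (74 : ℝ)]
  calc 74 * (n * (t * m)) ≤ Real.exp 74 * (Real.exp (s ^ 32) * Real.exp (4 * s ^ 28)) := by
        rw [← h.n_eq]
        gcongr
    _ = Real.exp (74 + (s ^ 32 + 4 * s ^ 28)) := by rw [Real.exp_add, Real.exp_add]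
    _ ≤ _ := by
        rw [Real.exp_le_exp]
        linarith [h.one_le_pow 31, h.pow_le_pow (show 28 ≤ 31 by norm_num)]

lemma lintegral_query_time_le (h : Regime n α β s) (hd : 1 ≤ d) {x : Fin n → E d}
    (hx : ∀ i, ‖x i‖ = 1) {q : E d} (hq : ‖q‖ = 1) :
    ∫⁻ a, (((TensorCloseTop1.construct α β x a).val.query q).time : ℝ≥0∞)
      ∂(gaussians d (levels n α) (filters n α β))
      ≤ ENNReal.ofReal (d * (n : ℝ) ^ (rho α β + 100 / s)) := by
  have hN := h.lintegral_numBuckets_le x hq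
  have hF := h.lintegral_numFar_le hx hq
  have hd' : (1 : ℝ) ≤ d := by exact_mod_cast hd
  have ht := h.one_le_levels
  have hm := h.one_le_filters
  have htm := h.levels_mul_filters_le
  have hmeas := TensorCloseTop1.measurable_numBuckets
    (D := fun a => (TensorCloseTop1.construct α β x a).val)
    (η := threshold α (filters n α β)) (fun a => ⟨rfl, rfl⟩) q
  set A := Real.exp (rho α β * s ^ 32 + 9 * s ^ 31) with hA
  have hA1 : 1 ≤ A := Real.one_le_exp
    (by have := h.rho_nonneg; have := h.s_pos; positivity)
  have hN' : ∫⁻ a, ((TensorCloseTop1.construct α β x a).val.numBuckets q : ℝ≥0∞)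
      ∂(gaussians d (levels n α) (filters n α β)) ≤ ENNReal.ofReal A := by
    refine hN.trans (ENNReal.ofReal_le_ofReal (Real.exp_le_exp.2 ?_))
    linarith [h.one_le_pow 31]
  set c : ℕ := levels n α * (filters n α β * (2 * d + 2) + 1) + levels n α + (2 * d + 1) with hc
  calc _ ≤ ∫⁻ a, ((c + (2 * levels n α + 1 : ℕ) *
          ((TensorCloseTop1.construct α β x a).val.numBuckets q : ℝ≥0∞)) + (2 * d + 1 : ℕ) *
          ((TensorCloseTop1.construct α β x a).val.numFar q : ℝ≥0∞))
          ∂(gaussians d (levels n α) (filters n α β)) := by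
        refine lintegral_mono fun a => ?_
        have := TensorCloseTop1.query_time_le (TensorCloseTop1.construct α β x a).val q
        norm_cast
        refine Nat.cast_le.2 (this.trans (le_of_eq ?_))
        rw [hc]
        ring
    _ = (c + (2 * levels n α + 1 : ℕ) *
          ∫⁻ a, ((TensorCloseTop1.construct α β x a).val.numBuckets q : ℝ≥0∞)
            ∂(gaussians d (levels n α) (filters n α β))) + (2 * d + 1 : ℕ) *
          ∫⁻ a, ((TensorCloseTop1.construct α β x a).val.numFar q : ℝ≥0∞)
            ∂(gaussians d (levels n α) (filters n α β)) := by
        -- Additivity of the integral needs measurability of one summand only, so nothing is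
        -- required of `numFar`.
        have hmeas' : Measurable fun a => (c : ℝ≥0∞) + (2 * levels n α + 1 : ℕ) *
            ((TensorCloseTop1.construct α β x a).val.numBuckets q : ℝ≥0∞) :=
          measurable_const.add (hmeas.const_mul _)
        rw [lintegral_add_left hmeas',
          lintegral_add_left measurable_const, lintegral_const_mul' _ _ (ENNReal.natCast_ne_top _),
          lintegral_const_mul' _ _ (ENNReal.natCast_ne_top _)]
        simp
    _ ≤ (c + (2 * levels n α + 1 : ℕ) * ENNReal.ofReal A) +
          (2 * d + 1 : ℕ) * ENNReal.ofReal A := by gcongr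
    _ = ENNReal.ofReal (c + (2 * levels n α + 1 : ℕ) * A + (2 * d + 1 : ℕ) * A) := by
        rw [ENNReal.ofReal_add (by positivity) (by positivity),
          ENNReal.ofReal_add (by positivity) (by positivity), ENNReal.ofReal_mul (by positivity),
          ENNReal.ofReal_mul (by positivity), ENNReal.ofReal_natCast, ENNReal.ofReal_natCast,
          ENNReal.ofReal_natCast]
    _ ≤ _ := ENNReal.ofReal_le_ofReal ?_
  rw [hc]
  push_cast
  set t : ℝ := (levels n α : ℝ)
  set m : ℝ := (filters n α β : ℝ)
  have htm1 : 1 ≤ t * m := one_le_mul_of_one_le_of_one_le ht hm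
  have h2 : t * (m * (2 * d + 2) + 1) + t + (2 * d + 1) + (2 * t + 1) * A + (2 * d + 1) * A
      ≤ 15 * (d * (A * (t * m))) := by
    have e1 : t ≤ t * m := le_mul_of_one_le_right (by linarith) hm
    have e2 : t * m ≤ d * (t * m) := le_mul_of_one_le_left (by linarith) hd'
    have e3 : (d : ℝ) ≤ d * (t * m) := le_mul_of_one_le_right (by linarith) htm1
    have e4 : d * (t * m) ≤ A * (d * (t * m)) := le_mul_of_one_le_left (by linarith) hA1
    have e5 : (2 * t + 1) + (2 * d + 1) ≤ 6 * (d * (t * m)) := by linarith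
    have e6 := mul_le_mul_of_nonneg_left e5 (by linarith : 0 ≤ A)
    nlinarith
  refine h2.trans ?_
  rw [h.rpow_eq, mul_left_comm]
  refine mul_le_mul_of_nonneg_left ?_ (by linarith)
  have h15 : (15 : ℝ) ≤ Real.exp 15 := by linarith [Real.add_one_le_exp (15 : ℝ)]
  calc 15 * (A * (t * m)) ≤ Real.exp 15 * (A * Real.exp (4 * s ^ 28)) := by gcongr
    _ = Real.exp (15 + (rho α β * s ^ 32 + 9 * s ^ 31 + 4 * s ^ 28)) := by
        rw [Real.exp_add, Real.exp_add _ (4 * s ^ 28)]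
    _ ≤ _ := by
        rw [Real.exp_le_exp]
        linarith [h.one_le_pow 31, h.pow_le_pow (show 28 ≤ 31 by norm_num)]

/-- The query misses a close point with small probability. -/
lemma gaussians_not_mem_inspected_le (h : Regime n α β s) {c : ℝ} (hc : 0 < c)
    (hcρ : c ≤ rho α β) (hcs : 9 ≤ c * s) {x : Fin n → E d} (hx : ∀ i, ‖x i‖ = 1) {q : E d}
    (hq : ‖q‖ = 1) {i : Fin n} (hi : α ≤ inner ℝ q (x i)) :
    gaussians d (levels n α) (filters n α β)
      {a | x i ∉ (TensorCloseTop1.construct α β x a).val.inspected q}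
      ≤ ENNReal.ofReal ((bandConst⁻¹ + Real.exp 1) * (4 / c) *
        (s ^ 24 * (1 - α ^ 2))⁻¹) := by
  have hM := h.log_filters_pos
  have hM' := h.le_log_filters'
  have hl := h.one_le_loglog
  have hls := h.loglog_le
  have ha := h.gap_pos
  have hs := h.s_pos
  have ht := h.one_le_levels
  have hta := h.levels_mul_le
  have hσ : c * s ^ 32 ≤ (1 - α ^ 2) * (levels n α * Real.log (filters n α β)) := by
    have h1 := mul_le_mul_of_nonneg_left h.le_log_filters ha.le
    have h2 := mul_le_mul_of_nonneg_right hcρ (pow_pos hs 32).le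
    rw [rho_eq] at h2
    linarith
  have hl2 : Real.log (Real.log (filters n α β)) ^ 2 ≤ Real.log (filters n α β) := by
    have h1 : Real.log (Real.log (filters n α β)) ^ 2 ≤ s ^ 2 :=
      pow_le_pow_left₀ (by linarith) hls 2
    have h2 : (4 : ℝ) ^ 2 ≤ s ^ 2 := pow_le_pow_left₀ (by norm_num) h.le_s 2
    nlinarith
  -- The chain is `9 ℓ³ ≤ 9 s³ ≤ c s⁴ ≤ 2 (1 - α²) M`, whence the requirement `9 ≤ c s`.
  have hl3 : 9 * Real.log (Real.log (filters n α β)) ^ 3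
      ≤ 4 * ((1 - α ^ 2) * Real.log (filters n α β)) := by
    have h1 : Real.log (Real.log (filters n α β)) ^ 3 ≤ s ^ 3 :=
      pow_le_pow_left₀ (by linarith) hls 3
    have h2 : c * s ^ 4 ≤ 2 * ((1 - α ^ 2) * Real.log (filters n α β)) := by
      have h3 : c * s ^ 32 ≤ s ^ 28 * (2 * ((1 - α ^ 2) * Real.log (filters n α β))) := by
        have := mul_le_mul_of_nonneg_left h.levels_le (mul_pos ha hM).le
        nlinarith
      refine le_of_mul_le_mul_left ?_ (pow_pos hs 28)
      linarith [show s ^ 28 * (c * s ^ 4) = c * s ^ 32 by ring]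
    have h4 := mul_le_mul_of_nonneg_right hcs (pow_pos hs 3).le
    nlinarith
  have e1 : {a | x i ∉ (TensorCloseTop1.construct α β x a).val.inspected q}
      = {a | ¬ ∀ k, TensorCloseTop1.Collides (threshold α (filters n α β)) q (x i) (a k)} := by
    ext a
    exact not_congr (TensorCloseTop1.mem_construct_inspected_iff α β x a q i)
  rw [e1]
  refine (TensorCloseTop1.gaussians_not_collides_le _ q (x i)
    (stdGaussian_band_inter_lt_threshold_le (hx i) hq h.α_pos h.α_lt hi hM hl hl3)).trans ?_
  refine (mul_le_mul' le_rfl (add_le_add_left (one_sub_stdGaussian_band_pow_le (hx i)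
    h.filters_pos hM hl hl2) _)).trans ?_
  rw [← ENNReal.ofReal_add (Real.exp_pos _).le (by positivity), ← ENNReal.ofReal_natCast,
    ← ENNReal.ofReal_mul (by positivity)]
  refine ENNReal.ofReal_le_ofReal ?_
  have hb := bandConst_pos
  set M := Real.log (filters n α β)
  set t : ℝ := (levels n α : ℝ)
  have h1 : Real.exp (-(bandConst * M)) ≤ bandConst⁻¹ / M := by
    rw [Real.exp_neg, div_eq_mul_inv, ← mul_inv]
    refine inv_anti₀ (by positivity) ?_
    linarith [Real.add_one_le_exp (bandConst * M)]
  -- Here `t / M` is `(t (1 - α²))²` divided by `(1 - α²) · (1 - α²) t M`: the numerator is at most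
  -- `4 s⁸`, and the last factor `(1 - α²) t M` is at least `c s³²`.
  have h2 : t / M ≤ 4 / c * (s ^ 24 * (1 - α ^ 2))⁻¹ := by
    rw [div_mul_eq_mul_div, ← div_eq_mul_inv, div_div, div_le_div_iff₀ hM (by positivity)]
    have h3 : t ^ 2 * (1 - α ^ 2) ^ 2 ≤ 4 * s ^ 8 := by
      have := pow_le_pow_left₀ (by positivity) hta 2
      nlinarith
    have h4 : (s ^ 8 * (t * (1 - α ^ 2))) * (t * (s ^ 24 * (1 - α ^ 2) * c))
        ≤ (s ^ 8 * (t * (1 - α ^ 2))) * (4 * M) := by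
      calc _ = (t ^ 2 * (1 - α ^ 2) ^ 2) * (c * s ^ 32) := by ring
        _ ≤ (4 * s ^ 8) * ((1 - α ^ 2) * (t * M)) := by gcongr
        _ = _ := by ring
    exact le_of_mul_le_mul_left h4 (by positivity)
  calc t * (Real.exp (-(bandConst * M)) + Real.exp 1 / M)
      ≤ t * (bandConst⁻¹ / M + Real.exp 1 / M) := by gcongr
    _ = (bandConst⁻¹ + Real.exp 1) * (t / M) := by ring
    _ ≤ (bandConst⁻¹ + Real.exp 1) * (4 / c * (s ^ 24 * (1 - α ^ 2))⁻¹) := by gcongr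
    _ = _ := by ring

end Regime

/-! ### From the asymptotic hypotheses to the theorem -/

lemma tendsto_log_rpow_atTop :
    Tendsto (fun n : ℕ => Real.log n ^ (1 / 32 : ℝ)) atTop atTop :=
  (tendsto_rpow_atTop (by norm_num)).comp
    (Real.tendsto_log_atTop.comp tendsto_natCast_atTop_atTop)

lemma log_rpow_pow (n : ℕ) : Real.log n = (Real.log n ^ (1 / 32 : ℝ)) ^ 32 := by
  rw [← Real.rpow_natCast, ← Real.rpow_mul (Real.log_natCast_nonneg n)]
  norm_num

lemma inv_log_rpow_pow (n : ℕ) :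
    ((Real.log n ^ (1 / 32 : ℝ)) ^ 24)⁻¹ = Real.log n ^ (-(3 / 4) : ℝ) := by
  rw [← Real.rpow_natCast, ← Real.rpow_mul (Real.log_natCast_nonneg n),
    ← Real.rpow_neg (Real.log_natCast_nonneg n)]
  norm_num

lemma eventually_regime {α β : ℕ → ℝ} (hβ : ∀ n, 0 < β n) (hβα : ∀ n, β n < α n)
    (hα : ∀ n, α n < 1)
    (hα' : (fun n : ℕ => Real.log n ^ (-(3 / 4) : ℝ)) =o[atTop] (fun n => 1 - α n ^ 2)) :
    ∀ᶠ n : ℕ in atTop, Regime n (α n) (β n) (Real.log n ^ (1 / 32 : ℝ)) := by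
  have h1 := tendsto_log_rpow_atTop
  have h2 : ∀ᶠ s : ℝ in atTop, Real.log (s ^ 32) ≤ s := by
    have h3 := Real.isLittleO_log_id_atTop.bound (show (0 : ℝ) < 1 / 32 by norm_num)
    filter_upwards [h3, Filter.eventually_ge_atTop 1] with s h4 h5
    rw [Real.log_pow]
    have h6 : Real.log s ≤ 1 / 32 * s := by
      refine (le_abs_self _).trans (h4.trans (le_of_eq ?_))
      rw [id, Real.norm_eq_abs, abs_of_pos (by linarith)]
    push_cast
    linarith
  filter_upwards [h1.eventually h2, h1.eventually_ge_atTop 4, hα'.bound one_pos] with n h3 h4 h5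
  refine ⟨hβ n, hβα n, hα n, log_rpow_pow n, h4, h3, ?_⟩
  rw [← inv_log_rpow_pow, one_mul, Real.norm_eq_abs, Real.norm_eq_abs,
    abs_of_pos (by positivity), abs_of_pos (by nlinarith [hβ n, hβα n, hα n])] at h5
  rwa [inv_le_iff_one_le_mul₀ (by positivity)] at h5

lemma one_le_of_norm_eq_one {d : ℕ} {x : E d} (hx : ‖x‖ = 1) : 1 ≤ d := by
  rcases Nat.eq_zero_or_pos d with rfl | h
  · have : x = 0 := Subsingleton.elim _ _
    simp [this] at hx
  · exact h

end TensorANN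

theorem mainTheorem5 (α β : ℕ → ℝ)
    (hβ : ∀ n, 0 < β n) (hβα : ∀ n, β n < α n) (hα : ∀ n, α n < 1)
    (hρ : (fun n => TensorANN.rho (α n) (β n)) =O[atTop] (fun _ => (1 : ℝ)))
    (hα' : (fun n : ℕ => Real.log n ^ (-(3 / 4) : ℝ)) =o[atTop] (fun n => 1 - α n ^ 2))
    (hαβ : (fun n : ℕ => √(Real.log (Real.log n) / Real.log n ^ (13 / 8 : ℝ)))
      =o[atTop] (fun n => α n - β n)) :
    (∃ (ε : ℕ → ℝ) (C : ℝ), Tendsto ε atTop (𝓝 0) ∧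
      ∀ᶠ n : ℕ in atTop, ∀ (d : ℕ) (x : Fin n → TensorANN.E d), (∀ i, ‖x i‖ = 1) →
        (∀ a, ((TensorANN.TensorCloseTop1.construct (α n) (β n) x a).val.space : ℝ)
          ≤ C * (d * n)) ∧
        (∀ a, ((TensorANN.TensorCloseTop1.construct (α n) (β n) x a).time : ℝ)
          ≤ d * (n : ℝ) ^ (1 + ε n)) ∧
        ∀ q : TensorANN.E d, ‖q‖ = 1 →
          (∫⁻ a, (((TensorANN.TensorCloseTop1.construct (α n) (β n) x a).val.query q).time : ℝ≥0∞)
              ∂(TensorANN.gaussians d (TensorANN.levels n (α n))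
                (TensorANN.filters n (α n) (β n)))
            ≤ ENNReal.ofReal (d * (n : ℝ) ^ (TensorANN.rho (α n) (β n) + ε n))) ∧
          (∫⁻ a, ((TensorANN.TensorCloseTop1.construct (α n) (β n) x a).val.numBuckets q : ℝ≥0∞)
              ∂(TensorANN.gaussians d (TensorANN.levels n (α n))
                (TensorANN.filters n (α n) (β n)))
            ≤ ENNReal.ofReal ((n : ℝ) ^ (TensorANN.rho (α n) (β n) + ε n))) ∧
          (∫⁻ a, ((TensorANN.TensorCloseTop1.construct (α n) (β n) x a).val.numFar q : ℝ≥0∞)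
              ∂(TensorANN.gaussians d (TensorANN.levels n (α n))
                (TensorANN.filters n (α n) (β n)))
            ≤ ENNReal.ofReal ((n : ℝ) ^ (TensorANN.rho (α n) (β n) + ε n)))) ∧
    ((fun _ : ℕ => (1 : ℝ)) =O[atTop] (fun n => TensorANN.rho (α n) (β n)) →
      ∃ δ : ℕ → ℝ, Tendsto δ atTop (𝓝 0) ∧
      ∀ᶠ n : ℕ in atTop, ∀ (d : ℕ) (x : Fin n → TensorANN.E d), (∀ i, ‖x i‖ = 1) →
        ∀ q : TensorANN.E d, ‖q‖ = 1 →
          ((∃ i, α n ≤ inner ℝ q (x i)) →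
            TensorANN.gaussians d (TensorANN.levels n (α n)) (TensorANN.filters n (α n) (β n))
              {a | ¬ TensorANN.IsNearNeighbor (β n) x q
                ((TensorANN.TensorCloseTop1.construct (α n) (β n) x a).val.query q).val}
              ≤ ENNReal.ofReal (δ n)) ∧
          (∀ i, α n ≤ inner ℝ q (x i) →
            TensorANN.gaussians d (TensorANN.levels n (α n)) (TensorANN.filters n (α n) (β n))
              {a | x i ∉ (TensorANN.TensorCloseTop1.construct (α n) (β n) x a).val.inspected q}
              ≤ ENNReal.ofReal (δ n))) := by
  have hreg := TensorANN.eventually_regime hβ hβα hα hα'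
  refine ⟨⟨fun n => 100 / Real.log n ^ (1 / 32 : ℝ), 9,
    tendsto_const_nhds.div_atTop TensorANN.tendsto_log_rpow_atTop, ?_⟩, fun hρ' => ?_⟩
  · filter_upwards [hreg] with n h d x hx
    have hd : 1 ≤ d := TensorANN.one_le_of_norm_eq_one
      (hx ⟨0, by exact_mod_cast h.n_pos⟩)
    refine ⟨h.construct_space_le hd x, h.construct_time_le hd x, fun q hq =>
      ⟨h.lintegral_query_time_le hd hx hq, ?_, ?_⟩⟩
    · refine (h.lintegral_numBuckets_le x hq).trans (ENNReal.ofReal_le_ofReal ?_)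
      rw [h.rpow_eq, Real.exp_le_exp]
      linarith [h.one_le_pow 31]
    · refine (h.lintegral_numFar_le hx hq).trans (ENNReal.ofReal_le_ofReal ?_)
      rw [h.rpow_eq, Real.exp_le_exp]
      linarith [h.one_le_pow 31]
  · obtain ⟨C, hC, hC'⟩ := hρ'.exists_pos
    refine ⟨fun n => (TensorANN.bandConst⁻¹ + Real.exp 1) * (4 / C⁻¹) *
      ((Real.log n ^ (1 / 32 : ℝ)) ^ 24 * (1 - α n ^ 2))⁻¹, ?_, ?_⟩
    -- As `s²⁴ = log^(3/4) n`, the failure bound is a constant times the quotient that the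
    -- hypothesis on `1 - α²` sends to `0`.
    · have h1 := hα'.tendsto_div_nhds_zero.const_mul
        ((TensorANN.bandConst⁻¹ + Real.exp 1) * (4 / C⁻¹))
      rw [mul_zero] at h1
      refine h1.congr fun n => ?_
      rw [← TensorANN.inv_log_rpow_pow, mul_inv, div_eq_mul_inv (_⁻¹ : ℝ)]
    · filter_upwards [hreg, hC'.bound,
        TensorANN.tendsto_log_rpow_atTop.eventually_ge_atTop (9 * C)] with n h h1 h2 d x hx q hq
      have hc : C⁻¹ ≤ TensorANN.rho (α n) (β n) := by
        rw [norm_one, Real.norm_eq_abs, abs_of_nonneg h.rho_nonneg] at h1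
        rwa [inv_le_iff_one_le_mul₀ hC, mul_comm]
      have hcs : 9 ≤ C⁻¹ * Real.log n ^ (1 / 32 : ℝ) := by
        rw [inv_mul_eq_div, le_div_iff₀ hC]
        exact h2
      have key i (hi : α n ≤ inner ℝ q (x i)) :=
        h.gaussians_not_mem_inspected_le (inv_pos.2 hC) hc hcs hx hq hi
      refine ⟨fun ⟨i, hi⟩ => (measure_mono ?_).trans (key i hi), key⟩
      intro a ha hmem
      refine ha ?_
      exact TensorANN.TensorCloseTop1.isNearNeighbor_of_mem_inspected _ _ x a q i
        (h.β_lt.le.trans hi) hmem
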